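/- Let $N\ge 1$ and let $\eta,\beta,h,T,\xi_-$ be complex numbers, $T\neq 0$ (in the physical setting $h$ and $T>0$ are real and $\beta=J\sinh(\eta)/T$). On $\mathbb C^2\otimes\mathbb C^2$, in the basis $|{+}{+}\rangle,|{+}{-}\rangle,|{-}{+}\rangle,|{-}{-}\rangle$, let $$R(u)=\begin{pmatrix}\sinh(u+\eta)&0&0&0\\0&\sinh u&\sinh\eta&0\\0&\sinh\eta&\sinh u&0\\0&0&0&\sinh(u+\eta)\end{pmatrix},\qquad K^-(u)=\begin{pmatrix}\sinh(u+\xi_-)&0\\0&\sinh(\xi_--u)\end{pmatrix}.$$ For $\lambda_1,\dots,\lambda_N\in\mathbb C$, with an auxiliary space $V_a\simeq\mathbb C^2$ and quantum spaces $V_1,\dots,V_N\simeq\mathbb C^2$, put $$\mathcal T_a(u)=R_{aN}(u-\lambda_N)\cdots R_{a1}(u-\lambda_1),\qquad \widehat{\mathcal T}_a(u)=R_{1a}(u+\lambda_1)\cdots R_{Na}(u+\lambda_N),$$ let $\mathcal C^-(u)$, an operator on $V_1\otimes\cdots\otimes V_N$, be the lower left entry (with respect to $V_a$) of $\mathcal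 T_a(u)K_a^-(u)\widehat{\mathcal T}_a(u)$, and define the partition function of the six-vertex model with reflecting ends by $$\mathcal Z_N(\{\xi_a\};\{\lambda_a\};\xi_-)=(0|\,\mathcal C^-(\xi_1)\cdots\mathcal C^-(\xi_N)\,|\bar 0),\qquad |0)=|{+}\rangle^{\otimes N},\quad |\bar 0)=|{-}\rangle^{\otimes N}.$$ Suppose that $\lambda_1,\dots,\lambda_N$ solve the Bethe equations of the quantum transfer matrix: for $p=1,\dots,N$, $$-1=e^{-h/T}\prod_{k=1}^N\frac{\sinh(\lambda_p-\lambda_k+\eta)}{\sinh(\lambda_p-\lambda_k-\eta)}\left[\frac{\sinh(\lambda_p+\frac{\beta}{N}-\eta)\sinh(\lambda_p-\frac{\beta}{N})}{\sinh(\lambda_p-\frac{\beta}{N}+\eta)\sinh(\lambda_p+\frac{\beta}{N})}\right]^N,$$ with all denominators non-zero, and that the denominators in the formulas below do not vanish: $\sinh(\lambda_a-\lambda_b)\ne0$ for $a\neq b$, and $\sinh(\lambda_a+\lambda_b)\neq 0$, $\sinh(\lambda_a+\lambda_b+\eta)\ne 0$ for all $a,b$. Then the homogeneous limit of $\mathcal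 Z_N$ as all $\xi_a\to-\beta/N$ exists, is the value of $\mathcal Z_N$ at $\xi_1=\dots=\xi_N=-\beta/N$, and $$\mathcal Z_N\big(\{-\tfrac{\beta}{N}\};\{\lambda_a\};\xi_-\big)=\prod_{a=1}^N\frac{\sinh(-2\beta/N)\sinh(\lambda_a+\xi_-)}{\sinh(2\lambda_a)}\prod_{1\le a<b\le N}\frac{\sinh(\lambda_a+\lambda_b+\eta)}{\sinh(\lambda_a+\lambda_b)}\prod_{a=1}^N\Big[\sinh(\lambda_a-\tfrac{\beta}{N})\sinh(\eta-\lambda_a-\tfrac{\beta}{N})\Big]^N\det_{1\le j,k\le N}\big[\delta_{jk}+U_{jk}\big],$$ where $$U_{jk}=\frac{-e^{-h/T}\sinh(2\lambda_k+\eta)}{\sinh(\lambda_k+\lambda_j)\sinh(\lambda_j-\lambda_k+\eta)}\;\frac{\prod_{a=1}^N\sinh(\lambda_k-\lambda_a+\eta)}{\prod_{a\ne k}\sinh(\lambda_k-\lambda_a)}\;\prod_{a=1}^N\frac{\sinh(\lambda_a+\lambda_k)}{\sinh(\lambda_a+\lambda_k+\eta)}.$$ Moreover, $U_{jk}=\widetilde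 U_{jk}$ for all $j,k$, where $\widetilde U_{jk}$ is the value at $\xi_1=\dots=\xi_N=-\beta/N$ of $$\frac{\sinh(2\lambda_k+\eta)}{\sinh(\lambda_k+\lambda_j)\sinh(\lambda_j-\lambda_k+\eta)}\;\frac{\prod_{a=1}^N\sinh(\lambda_k-\lambda_a-\eta)}{\prod_{a\neq k}\sinh(\lambda_k-\lambda_a)}\;\prod_{a=1}^N\frac{\sinh(\lambda_a+\lambda_k)}{\sinh(\lambda_a+\lambda_k+\eta)}\;\prod_{a=1}^N\frac{\sinh(\xi_a-\lambda_k)\sinh(\xi_a+\lambda_k+\eta)}{\sinh(\xi_a+\lambda_k)\sinh(\xi_a-\lambda_k+\eta)}.$$ -/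

import Mathlib

namespace OpenXXZ

noncomputable section

/-- Basis index set of the quantum space `V₁ ⊗ … ⊗ V_N`, each `V_k ≃ ℂ²`.
In every factor, `0` labels the spin up vector `|+⟩` and `1` the spin down vector `|-⟩`. -/
abbrev Config (N : ℕ) : Type := Fin N → Fin 2

/-- Operators on the quantum space, as matrices in the canonical basis. -/
abbrev QOp (N : ℕ) : Type := Matrix (Config N) (Config N) ℂ

/-- Operators on `V_a ⊗ (V₁ ⊗ … ⊗ V_N)`: `2 × 2` matrices in the auxiliary space whose entries
are operators on the quantum space. -/
abbrev AuxOp (N : ℕ) : Type := Matrix (Fin 2) (Fin 2) (QOp N)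

/-- The six-vertex `R`-matrix in the polynomial normalization, on `ℂ² ⊗ ℂ²`.
The `4 × 4` display is in the ordered basis `++, +-, -+, --`. -/
def Rmat (η u : ℂ) : Matrix (Fin 2 × Fin 2) (Fin 2 × Fin 2) ℂ :=
  (!![Complex.sinh (u + η), 0, 0, 0;
      0, Complex.sinh u, Complex.sinh η, 0;
      0, Complex.sinh η, Complex.sinh u, 0;
      0, 0, 0, Complex.sinh (u + η)] : Matrix (Fin 4) (Fin 4) ℂ).submatrix
    finProdFinEquiv finProdFinEquiv

/-- The operator acting as `A` on `V_k` and as the identity on all other sites. -/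
def siteOp {N : ℕ} (k : Fin N) (A : Matrix (Fin 2) (Fin 2) ℂ) : QOp N :=
  Matrix.of fun σ τ => if ∀ l, l ≠ k → σ l = τ l then A (σ k) (τ k) else 0

/-- `R_{ak}(u)`: the first tensor factor is the auxiliary space, the second one is site `k`. -/
def Rak {N : ℕ} (η : ℂ) (k : Fin N) (u : ℂ) : AuxOp N :=
  Matrix.of fun s t => siteOp k (Matrix.of fun i j => Rmat η u (s, i) (t, j))

/-- `R_{ka}(u)`: the first tensor factor is site `k`, the second one is the auxiliary space. -/
def Rka {N : ℕ} (η : ℂ) (k : Fin N) (u : ℂ) : AuxOp N :=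
  Matrix.of fun s t => siteOp k (Matrix.of fun i j => Rmat η u (i, s) (j, t))

/-- `T_a(u) = R_{aN}(u - λ_N) ⋯ R_{a1}(u - λ_1)`. -/
def monodromy {N : ℕ} (η : ℂ) (lam : Fin N → ℂ) (u : ℂ) : AuxOp N :=
  (List.ofFn fun k : Fin N => Rak η k (u - lam k)).reverse.prod

/-- `T̂_a(u) = R_{1a}(u + λ_1) ⋯ R_{Na}(u + λ_N)`. -/
def monodromyHat {N : ℕ} (η : ℂ) (lam : Fin N → ℂ) (u : ℂ) : AuxOp N :=
  (List.ofFn fun k : Fin N => Rka η k (u + lam k)).prod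

/-- The diagonal solution `K(u; ξ)` of the reflection equation. -/
def Kmat (ξ u : ℂ) : Matrix (Fin 2) (Fin 2) ℂ :=
  !![Complex.sinh (u + ξ), 0; 0, Complex.sinh (ξ - u)]

/-- `K⁻(u) = K(u + η/2 - η/2; ξ₋) = K(u; ξ₋)` acting on the auxiliary space. -/
def Kminus (N : ℕ) (ξm u : ℂ) : AuxOp N :=
  Matrix.of fun s t => Kmat ξm u s t • (1 : QOp N)

/-- The boundary monodromy matrix `U⁻_a(u) = T_a(u) K⁻_a(u) T̂_a(u)`. -/
def boundaryMonodromy {N : ℕ} (η : ℂ) (lam : Fin N → ℂ) (ξm u : ℂ) : AuxOp N :=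
  monodromy η lam u * Kminus N ξm u * monodromyHat η lam u

/-- The lower left entry `C⁻(u)` of the boundary monodromy matrix. -/
def Cminus {N : ℕ} (η : ℂ) (lam : Fin N → ℂ) (ξm u : ℂ) : QOp N :=
  boundaryMonodromy η lam ξm u 1 0

/-- The partition function of the six-vertex model with reflecting ends,
`Z_N({ξ_a}; {λ_k}; ξ₋) = (0| C⁻(ξ_1) ⋯ C⁻(ξ_N) |0̄)`, where `|0)` has all spins up and
`|0̄)` has all spins down. -/
def partitionZ {N : ℕ} (η : ℂ) (xi lam : Fin N → ℂ) (ξm : ℂ) : ℂ :=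
  (List.ofFn fun a : Fin N => Cminus η lam ξm (xi a)).prod (fun _ => 0) (fun _ => 1)

/-- The Bethe equations of the quantum transfer matrix with `N` Bethe roots and Trotter number
`N`. A solution makes every denominator below nonzero, since the division by zero convention
would turn the right-hand side into `0`. -/
def SolvesBethe {N : ℕ} (η β h T : ℂ) (lam : Fin N → ℂ) : Prop :=
  ∀ p : Fin N, (-1 : ℂ) =
    Complex.exp (-(h / T)) *
      (∏ k : Fin N, Complex.sinh (lam p - lam k + η) / Complex.sinh (lam p - lam k - η)) *
      ((Complex.sinh (lam p + β / N - η) * Complex.sinh (lam p - β / N)) /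
        (Complex.sinh (lam p - β / N + η) * Complex.sinh (lam p + β / N))) ^ N

/-- The matrix `U`. It depends on `h` and `T` only through `hT = h / T`. -/
def matU {N : ℕ} (η hT : ℂ) (lam : Fin N → ℂ) : Matrix (Fin N) (Fin N) ℂ :=
  Matrix.of fun j k =>
    (-(Complex.exp (-hT) * Complex.sinh (2 * lam k + η)) /
        (Complex.sinh (lam k + lam j) * Complex.sinh (lam j - lam k + η))) *
      ((∏ a : Fin N, Complex.sinh (lam k - lam a + η)) /
        ∏ a ∈ Finset.univ.erase k, Complex.sinh (lam k - lam a)) *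
      ∏ a : Fin N, Complex.sinh (lam a + lam k) / Complex.sinh (lam a + lam k + η)

/-- The inhomogeneous matrix `Ũ`, which depends on the `ξ_a` and `λ_a`. -/
def matUtilde {N : ℕ} (η : ℂ) (xi lam : Fin N → ℂ) : Matrix (Fin N) (Fin N) ℂ :=
  Matrix.of fun j k =>
    (Complex.sinh (2 * lam k + η) /
        (Complex.sinh (lam k + lam j) * Complex.sinh (lam j - lam k + η))) *
      ((∏ a : Fin N, Complex.sinh (lam k - lam a - η)) /
        ∏ a ∈ Finset.univ.erase k, Complex.sinh (lam k - lam a)) *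
      (∏ a : Fin N, Complex.sinh (lam a + lam k) / Complex.sinh (lam a + lam k + η)) *
      ∏ a : Fin N, (Complex.sinh (xi a - lam k) * Complex.sinh (xi a + lam k + η)) /
        (Complex.sinh (xi a + lam k) * Complex.sinh (xi a - lam k + η))

/-- The closed form of the homogeneous partition function: product prefactors times
`det_N [δ_{jk} + U_{jk}]`. -/
def homogeneousForm {N : ℕ} (η β hT ξm : ℂ) (lam : Fin N → ℂ) : ℂ :=
  (∏ a : Fin N, (Complex.sinh (-2 * (β / N)) * Complex.sinh (lam a + ξm)) /
      Complex.sinh (2 * lam a)) *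
    (∏ a : Fin N, ∏ b ∈ Finset.Ioi a,
      Complex.sinh (lam a + lam b + η) / Complex.sinh (lam a + lam b)) *
    (∏ a : Fin N, (Complex.sinh (lam a - β / N) * Complex.sinh (η - lam a - β / N)) ^ N) *
    (1 + matU η hT lam).det

end

end OpenXXZ

/-!
The formula holds before any Bethe equation is imposed: for all horizontal parameters `ξ_a` the
partition function is the product of prefactors in `inhomogeneousForm` times `det (1 + Ũ)`
(`partitionZ_eq_inhomogeneousForm`). The Bethe equation for `λ_k` then eliminates the `ξ_a` from the
`k`-th column of `Ũ` at `ξ_a = -β / N` and turns `Ũ` into `U` (`SolvesBethe.matUtilde_eq_matU`).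

The inhomogeneous formula comes from a determinant in the style of Izergin, Korepin and Tsuchiya
(`detFormula`), kept free of denominators by multiplying with the Vandermonde determinants in
`cosh (2 ξ_a + η)` and `cosh (2 λ_b)`. It is proved by induction on `N`. Both sides, as functions of
the last `λ`, are trigonometric polynomials with `4 N + 2` coefficients on `N + 1` sites
(`trigPoly_partitionZ`, `trigPoly_det_weightMatrix`), so `4 N + 2` points of agreement suffice. At
the `2 N` points `± λ_b` both sides vanish. At `λ = ξ_first` and `λ = -ξ_last` a double row and the
last column are frozen and the partition function reduces to the one with one site less
(`partitionZ_cons_snoc`, `partitionZ_snoc_snoc_neg`). Since the operators `C⁻(ξ_a)` commute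
(`Cminus_commute`), these evaluations hold at all `± ξ_a`. The commutation follows from the
reflection equation, which is carried from `K⁻` to the boundary monodromy matrix site by site with
the Yang-Baxter equation.

Partial fractions identify the determinant with that of a difference of two Cauchy matrices. Taking
out the first one leaves `det (1 + Ũ)`, up to conjugation by a diagonal matrix
(`det_cauchy_sub_cauchy`, `matUtilde_eq`). The division by the Vandermonde determinants needs
generic `ξ_a`. Both the closed form and the partition function are continuous at the homogeneous
point, where the Bethe equations guarantee that no denominator vanishes, so the identity extends
to it.
-/

namespace OpenXXZ

open Matrix

/-! ### Operators acting on one site -/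

theorem sum_config_succ {M : Type*} [AddCommMonoid M] {N : ℕ} (f : Config (N + 1) → M) :
    ∑ ρ, f ρ = ∑ ρ : Config N, ∑ j : Fin 2, f (Fin.snoc ρ j) := by
  rw [← (Fin.snocEquiv (fun _ : Fin (N + 1) => Fin 2)).sum_comp, Fintype.sum_prod_type_right]
  rfl

theorem siteOp_one {N : ℕ} (k : Fin N) : siteOp k (1 : Matrix (Fin 2) (Fin 2) ℂ) = 1 := by
  ext σ τ
  simp only [siteOp, Matrix.of_apply, Matrix.one_apply]
  by_cases h : σ = τ
  · simp [h]
  · rw [if_neg h]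
    split_ifs with h1 h2
    · refine absurd (funext fun l => ?_) h
      by_cases hl : l = k
      · rw [hl, h2]
      · exact h1 l hl
    · rfl
    · rfl

theorem siteOp_mul {N : ℕ} (k : Fin N) (A B : Matrix (Fin 2) (Fin 2) ℂ) :
    siteOp k (A * B) = siteOp k A * siteOp k B := by
  ext σ τ
  simp only [siteOp, Matrix.of_apply, Matrix.mul_apply]
  have key : ∀ ρ : Config N, ρ ∉ Finset.univ.image (fun j : Fin 2 => Function.update σ k j) →
      ((if ∀ l, l ≠ k → σ l = ρ l then A (σ k) (ρ k) else 0) *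
        if ∀ l, l ≠ k → ρ l = τ l then B (ρ k) (τ k) else 0) = 0 := by
    intro ρ hρ
    rw [if_neg, zero_mul]
    intro h
    refine hρ (Finset.mem_image.2 ⟨ρ k, Finset.mem_univ _, funext fun l => ?_⟩)
    by_cases hl : l = k
    · subst hl; simp
    · simp [hl, h l hl]
  rw [← Finset.sum_subset (Finset.subset_univ _) (fun ρ _ hρ => key ρ hρ),
    Finset.sum_image (fun a _ b _ h => Function.update_injective σ k h)]
  by_cases h : ∀ l, l ≠ k → σ l = τ l
  · rw [if_pos h]
    refine Finset.sum_congr rfl fun j _ => ?_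
    rw [if_pos, if_pos]
    · simp
    · intro l hl; simp [hl, h l hl]
    · intro l hl; simp [hl]
  · rw [if_neg h]
    refine (Finset.sum_eq_zero fun j _ => ?_).symm
    have h2 : ¬ ∀ l, l ≠ k → Function.update σ k j l = τ l :=
      fun h' => h fun l hl => by simpa [hl] using h' l hl
    rw [if_neg h2, mul_zero]

/-- `siteOp k` as a ring homomorphism. -/
noncomputable def siteHom {N : ℕ} (k : Fin N) : Matrix (Fin 2) (Fin 2) ℂ →+* QOp N where
  toFun := siteOp k
  map_one' := siteOp_one k
  map_mul' := siteOp_mul k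
  map_zero' := by ext σ τ; simp [siteOp]
  map_add' A B := by
    ext σ τ
    simp only [siteOp, Matrix.of_apply, Matrix.add_apply]
    split_ifs <;> simp

theorem siteOp_smul_one {N : ℕ} (k : Fin N) (c : ℂ) :
    siteOp k (c • (1 : Matrix (Fin 2) (Fin 2) ℂ)) = c • 1 := by
  rw [← siteOp_one k]
  ext σ τ
  simp only [siteOp, Matrix.of_apply, Matrix.smul_apply]
  split_ifs <;> simp

theorem siteOp_mul_siteOp_apply {N : ℕ} {k l : Fin N} (hkl : k ≠ l)
    (A B : Matrix (Fin 2) (Fin 2) ℂ) (σ τ : Config N) :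
    (siteOp k A * siteOp l B) σ τ =
      if ∀ m, m ≠ k → m ≠ l → σ m = τ m then A (σ k) (τ k) * B (σ l) (τ l) else 0 := by
  simp only [siteOp, Matrix.of_apply, Matrix.mul_apply]
  rw [Finset.sum_eq_single (Function.update σ k (τ k))]
  · have h1 : ∀ m, m ≠ k → σ m = Function.update σ k (τ k) m := by
      intro m hm; simp [hm]
    rw [if_pos h1]
    by_cases h : ∀ m, m ≠ k → m ≠ l → σ m = τ m
    · rw [if_pos h, if_pos]
      · simp [hkl.symm]
      · intro m hm
        by_cases hmk : m = k
        · subst hmk; simp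
        · simp [hmk, h m hmk hm]
    · rw [if_neg h, if_neg, mul_zero]
      intro h'
      refine h fun m hm hml => ?_
      simpa [hm] using h' m hml
  · intro ρ _ hρ
    by_cases h : ∀ m, m ≠ k → σ m = ρ m
    · rw [if_neg (c := ∀ m, m ≠ l → ρ m = τ m), mul_zero]
      intro h'
      refine hρ (funext fun m => ?_)
      by_cases hmk : m = k
      · subst hmk; simpa using h' m hkl
      · simp [hmk, h m hmk]
    · rw [if_neg h, zero_mul]
  · simp

theorem siteOp_commute {N : ℕ} {k l : Fin N} (hkl : k ≠ l) (A B : Matrix (Fin 2) (Fin 2) ℂ) :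
    Commute (siteOp k A) (siteOp l B) := by
  ext σ τ
  rw [siteOp_mul_siteOp_apply hkl, siteOp_mul_siteOp_apply hkl.symm, mul_comm]
  congr 1
  exact propext ⟨fun h m h1 h2 => h m h2 h1, fun h m h1 h2 => h m h2 h1⟩

/-! ### Adding a last site -/

/-- The operator `X ⊗ 1` on `N + 1` sites, acting as the identity on the last site. -/
noncomputable def liftHom (N : ℕ) : QOp N →+* QOp (N + 1) where
  toFun X := Matrix.of fun σ τ =>
    if σ (Fin.last N) = τ (Fin.last N) then X (Fin.init σ) (Fin.init τ) else 0
  map_one' := by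
    ext σ τ
    induction σ using Fin.snocCases with | _ σ i => ?_
    induction τ using Fin.snocCases with | _ τ j => ?_
    simp [Matrix.one_apply, Fin.snoc_inj]
    split_ifs <;> simp_all
  map_mul' X Y := by
    ext σ τ
    simp only [Matrix.of_apply, Matrix.mul_apply, sum_config_succ, Fin.snoc_last, Fin.init_snoc]
    by_cases h : σ (Fin.last N) = τ (Fin.last N)
    · simp [h]
    · rw [if_neg h]
      refine (Finset.sum_eq_zero fun ρ _ => Finset.sum_eq_zero fun j _ => ?_).symm
      split_ifs with h1 h2
      · exact absurd (h1.trans h2) h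
      all_goals simp
  map_zero' := by ext σ τ; simp
  map_add' X Y := by
    ext σ τ
    simp only [Matrix.of_apply, Matrix.add_apply]
    split_ifs <;> simp

theorem liftHom_snoc {N : ℕ} (X : QOp N) (σ τ : Config N) (i j : Fin 2) :
    liftHom N X (Fin.snoc σ i) (Fin.snoc τ j) = if i = j then X σ τ else 0 := by
  simp [liftHom]

theorem siteOp_last_snoc {N : ℕ} (A : Matrix (Fin 2) (Fin 2) ℂ) (σ τ : Config N) (i j : Fin 2) :
    siteOp (Fin.last N) A (Fin.snoc σ i) (Fin.snoc τ j) = if σ = τ then A i j else 0 := by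
  simp only [siteOp, Matrix.of_apply, Fin.snoc_last]
  congr 1
  simp only [Fin.forall_fin_succ', Fin.snoc_castSucc, Fin.snoc_last, ne_eq, not_true_eq_false,
    false_imp_iff, and_true, funext_iff]
  simp [Fin.castSucc_ne_last]

theorem siteOp_castSucc {N : ℕ} (k : Fin N) (A : Matrix (Fin 2) (Fin 2) ℂ) :
    siteOp k.castSucc A = liftHom N (siteOp k A) := by
  ext σ τ
  induction σ using Fin.snocCases with | _ σ i => ?_
  induction τ using Fin.snocCases with | _ τ j => ?_
  rw [liftHom_snoc]
  simp only [siteOp, Matrix.of_apply, Fin.snoc_castSucc, Fin.forall_fin_succ', Fin.snoc_last]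
  have : Fin.last N ≠ k.castSucc := (Fin.castSucc_ne_last k).symm
  by_cases h : i = j <;> simp [h, this, Fin.castSucc_inj]

theorem liftHom_smul_one {N : ℕ} (c : ℂ) : liftHom N (c • (1 : QOp N)) = c • 1 := by
  rw [← map_one (liftHom N)]
  ext σ τ
  induction σ using Fin.snocCases with | _ σ i => ?_
  induction τ using Fin.snocCases with | _ τ j => ?_
  simp only [liftHom_snoc, Matrix.smul_apply]
  split_ifs <;> simp

/-- Sandwiching an operator on the first `N` sites between two operators on the last site. -/
theorem siteOp_last_mul_liftHom_mul_apply {N : ℕ} (X : QOp N) (A B : Matrix (Fin 2) (Fin 2) ℂ)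
    (σ τ : Config N) (i j : Fin 2) :
    (siteOp (Fin.last N) A * liftHom N X * siteOp (Fin.last N) B)
        (Fin.snoc σ i) (Fin.snoc τ j) = (A * B) i j * X σ τ := by
  have h : ∀ (ρ : Config N) (l : Fin 2), (siteOp (Fin.last N) A * liftHom N X)
      (Fin.snoc σ i) (Fin.snoc ρ l) = A i l * X σ ρ := by
    intro ρ l
    rw [Matrix.mul_apply, sum_config_succ]
    simp [siteOp_last_snoc, liftHom_snoc]
  rw [Matrix.mul_apply, sum_config_succ]
  simp only [h, siteOp_last_snoc, mul_ite, mul_zero]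
  rw [Finset.sum_comm]
  simp only [Finset.sum_ite_eq', Finset.mem_univ, if_true, Matrix.mul_apply, Finset.sum_mul]
  exact Finset.sum_congr rfl fun l _ => by ring

/-! ### The boundary monodromy matrix and its last site -/

theorem Rmat_apply (η u : ℂ) (s i t j : Fin 2) :
    Rmat η u (s, i) (t, j) =
      if s = t ∧ i = j then (if s = i then Complex.sinh (u + η) else Complex.sinh u)
      else if s = j ∧ i = t then Complex.sinh η else 0 := by
  fin_cases s <;> fin_cases i <;> fin_cases t <;> fin_cases j <;> rfl

/-- `P R P = R`, so that the order of the two spaces is immaterial. -/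
theorem Rka_eq_Rak {N : ℕ} (η : ℂ) (k : Fin N) (u : ℂ) : Rka η k u = Rak η k u := by
  ext s t : 2
  simp only [Rka, Rak, Matrix.of_apply]
  congr 1
  ext i j
  simp only [Matrix.of_apply, Rmat_apply]
  fin_cases s <;> fin_cases i <;> fin_cases t <;> fin_cases j <;> simp

theorem monodromy_succ {N : ℕ} (η : ℂ) (lam : Fin (N + 1) → ℂ) (u : ℂ) :
    monodromy η lam u = Rak η (Fin.last N) (u - lam (Fin.last N)) *
      (monodromy η (Fin.init lam) u).map (liftHom N) := by
  have h : (monodromy η (Fin.init lam) u).map (liftHom N) =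
      (liftHom N).mapMatrix (monodromy η (Fin.init lam) u) := rfl
  rw [h, monodromy, monodromy, List.ofFn_succ_last, List.reverse_append, List.reverse_singleton,
    List.singleton_append, List.prod_cons, map_list_prod, List.map_reverse, List.map_ofFn]
  congr 4
  funext k
  ext s t : 2
  simp [Rak, siteOp_castSucc, Fin.init]

theorem monodromyHat_succ {N : ℕ} (η : ℂ) (lam : Fin (N + 1) → ℂ) (u : ℂ) :
    monodromyHat η lam u = (monodromyHat η (Fin.init lam) u).map (liftHom N) *
      Rka η (Fin.last N) (u + lam (Fin.last N)) := by
  have h : (monodromyHat η (Fin.init lam) u).map (liftHom N) =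
      (liftHom N).mapMatrix (monodromyHat η (Fin.init lam) u) := rfl
  rw [h, monodromyHat, monodromyHat, List.ofFn_succ_last, List.prod_append, List.prod_singleton,
    map_list_prod, List.map_ofFn]
  congr 3
  funext k
  ext s t : 2
  simp [Rka, siteOp_castSucc, Fin.init]

theorem boundaryMonodromy_succ {N : ℕ} (η : ℂ) (lam : Fin (N + 1) → ℂ) (ξm u : ℂ) :
    boundaryMonodromy η lam ξm u = Rak η (Fin.last N) (u - lam (Fin.last N)) *
      (boundaryMonodromy η (Fin.init lam) ξm u).map (liftHom N) *
      Rka η (Fin.last N) (u + lam (Fin.last N)) := by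
  have hK : Kminus (N + 1) ξm u = (Kminus N ξm u).map (liftHom N) := by
    ext s t : 2
    simp [Kminus, liftHom_smul_one]
  simp only [boundaryMonodromy, monodromy_succ η lam, monodromyHat_succ η lam, Matrix.map_mul, hK,
    mul_assoc]

/-- The boundary monodromy matrix on `N + 1` sites, written as a `2 × 2` matrix in the last site. -/
theorem boundaryMonodromy_snoc {N : ℕ} (η : ℂ) (lam : Fin (N + 1) → ℂ) (ξm u : ℂ) (s t : Fin 2)
    (σ τ : Config N) (i j : Fin 2) :
    boundaryMonodromy η lam ξm u s t (Fin.snoc σ i) (Fin.snoc τ j) =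
      ∑ t', ∑ s', ∑ m, Rmat η (u - lam (Fin.last N)) (s, i) (s', m) *
        Rmat η (u + lam (Fin.last N)) (m, t') (j, t) *
        boundaryMonodromy η (Fin.init lam) ξm u s' t' σ τ := by
  rw [boundaryMonodromy_succ, Matrix.mul_apply, Matrix.sum_apply]
  refine Finset.sum_congr rfl fun t' _ => ?_
  rw [Matrix.mul_apply (i := s), Finset.sum_mul, Matrix.sum_apply]
  refine Finset.sum_congr rfl fun s' _ => ?_
  simp only [Rak, Rka, Matrix.of_apply, Matrix.map_apply, siteOp_last_mul_liftHom_mul_apply]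
  rw [Matrix.mul_apply, Finset.sum_mul]
  rfl

/-! ### Frozen lines -/

/-- A left spin down on the last site stays down under `C⁻`. -/
theorem Cminus_snoc_one_left {N : ℕ} (η : ℂ) (lam : Fin (N + 1) → ℂ) (ξm u : ℂ)
    (σ τ : Config N) (j : Fin 2) :
    Cminus η lam ξm u (Fin.snoc σ 1) (Fin.snoc τ j) =
      if j = 1 then Complex.sinh (u - lam (Fin.last N) + η) * Complex.sinh (u + lam (Fin.last N)) *
        Cminus η (Fin.init lam) ξm u σ τ else 0 := by
  rw [Cminus, boundaryMonodromy_snoc]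
  fin_cases j <;> simp [Rmat_apply, Fin.sum_univ_two, Cminus]

/-- A right spin up on the last site stays up under `C⁻`. -/
theorem Cminus_snoc_zero_right {N : ℕ} (η : ℂ) (lam : Fin (N + 1) → ℂ) (ξm u : ℂ)
    (σ τ : Config N) (i : Fin 2) :
    Cminus η lam ξm u (Fin.snoc σ i) (Fin.snoc τ 0) =
      if i = 0 then Complex.sinh (u - lam (Fin.last N)) * Complex.sinh (u + lam (Fin.last N) + η) *
        Cminus η (Fin.init lam) ξm u σ τ else 0 := by
  rw [Cminus, boundaryMonodromy_snoc]
  fin_cases i <;> simp [Rmat_apply, Fin.sum_univ_two, Cminus]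

theorem Cminus_snoc_zero_one {N : ℕ} (η : ℂ) (lam : Fin (N + 1) → ℂ) (ξm u : ℂ) (σ τ : Config N) :
    Cminus η lam ξm u (Fin.snoc σ 0) (Fin.snoc τ 1) =
      Complex.sinh η * (Complex.sinh (u + lam (Fin.last N)) *
          boundaryMonodromy η (Fin.init lam) ξm u 0 0 σ τ +
        Complex.sinh (u - lam (Fin.last N)) *
          boundaryMonodromy η (Fin.init lam) ξm u 1 1 σ τ) := by
  rw [Cminus, boundaryMonodromy_snoc]
  simp [Rmat_apply, Fin.sum_univ_two]
  ring

theorem Cminus_snoc_zero_zero {N : ℕ} (η : ℂ) (lam : Fin (N + 1) → ℂ) (ξm u : ℂ)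
    (σ τ : Config N) :
    Cminus η lam ξm u (Fin.snoc σ 0) (Fin.snoc τ 0) =
      Complex.sinh (u - lam (Fin.last N)) * Complex.sinh (u + lam (Fin.last N) + η) *
        Cminus η (Fin.init lam) ξm u σ τ := by
  rw [Cminus_snoc_zero_right, if_pos rfl]

theorem Cminus_snoc_one_one {N : ℕ} (η : ℂ) (lam : Fin (N + 1) → ℂ) (ξm u : ℂ)
    (σ τ : Config N) :
    Cminus η lam ξm u (Fin.snoc σ 1) (Fin.snoc τ 1) =
      Complex.sinh (u - lam (Fin.last N) + η) * Complex.sinh (u + lam (Fin.last N)) *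
        Cminus η (Fin.init lam) ξm u σ τ := by
  rw [Cminus_snoc_one_left, if_pos rfl]

/-! ### Action on the two vacua -/

theorem const_eq_snoc {N : ℕ} (i : Fin 2) :
    (fun _ => i : Config (N + 1)) = Fin.snoc (fun _ => i : Config N) i := by
  funext k
  refine Fin.lastCases ?_ (fun k => ?_) k <;> simp

theorem boundaryMonodromy_up {N : ℕ} (η : ℂ) (lam : Fin N → ℂ) (ξm u : ℂ) (τ : Config N) :
    boundaryMonodromy η lam ξm u 0 1 (fun _ => 0) τ = 0 ∧
    boundaryMonodromy η lam ξm u 0 0 (fun _ => 0) τ = if τ = fun _ => 0 then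
      Complex.sinh (u + ξm) *
        ∏ k, Complex.sinh (u - lam k + η) * Complex.sinh (u + lam k + η) else 0 := by
  induction N with
  | zero =>
    have hτ : τ = fun _ => 0 := Subsingleton.elim _ _
    simp [boundaryMonodromy, monodromy, monodromyHat, Kminus, Kmat, hτ]
  | succ N ih =>
    induction τ using Fin.snocCases with | _ τ j => ?_
    obtain ⟨h1, h2⟩ := ih (Fin.init lam) τ
    rw [const_eq_snoc, boundaryMonodromy_snoc, boundaryMonodromy_snoc, Fin.prod_univ_castSucc]
    simp only [Fin.snoc_inj, Fin.init] at h1 h2 ⊢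
    fin_cases j
    · simp [Rmat_apply, Fin.sum_univ_two, h1, h2]
      split_ifs <;> ring
    · simp [Rmat_apply, Fin.sum_univ_two, h1]

theorem boundaryMonodromy_down {N : ℕ} (η : ℂ) (lam : Fin N → ℂ) (ξm u : ℂ) (σ : Config N) :
    boundaryMonodromy η lam ξm u 0 1 σ (fun _ => 1) = 0 ∧
    boundaryMonodromy η lam ξm u 1 1 σ (fun _ => 1) = if σ = fun _ => 1 then
      Complex.sinh (ξm - u) *
        ∏ k, Complex.sinh (u - lam k + η) * Complex.sinh (u + lam k + η) else 0 := by
  induction N with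
  | zero =>
    have hσ : σ = fun _ => 1 := Subsingleton.elim _ _
    simp [boundaryMonodromy, monodromy, monodromyHat, Kminus, Kmat, hσ]
  | succ N ih =>
    induction σ using Fin.snocCases with | _ σ i => ?_
    obtain ⟨h1, h2⟩ := ih (Fin.init lam) σ
    rw [const_eq_snoc, boundaryMonodromy_snoc, boundaryMonodromy_snoc, Fin.prod_univ_castSucc]
    simp only [Fin.snoc_inj, Fin.init] at h1 h2 ⊢
    fin_cases i
    · simp [Rmat_apply, Fin.sum_univ_two, h1]
    · simp [Rmat_apply, Fin.sum_univ_two, h1, h2]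
      split_ifs <;> ring

/-! ### Recursion of the partition function -/

theorem prod_Cminus_snoc_one_left {N : ℕ} (η : ℂ) (lam : Fin (N + 1) → ℂ) (ξm : ℂ) (l : List ℂ)
    (σ τ : Config N) (j : Fin 2) :
    (l.map (Cminus η lam ξm)).prod (Fin.snoc σ 1) (Fin.snoc τ j) =
      if j = 1 then (l.map fun u => Complex.sinh (u - lam (Fin.last N) + η) *
          Complex.sinh (u + lam (Fin.last N))).prod *
        (l.map (Cminus η (Fin.init lam) ξm)).prod σ τ else 0 := by
  induction l generalizing σ with
  | nil => simp [Matrix.one_apply, Fin.snoc_inj, eq_comm, ite_and]; split_ifs <;> rfl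
  | cons u l ih =>
    simp only [List.map_cons, List.prod_cons, Matrix.mul_apply, sum_config_succ,
      Cminus_snoc_one_left, ite_mul, zero_mul, Finset.sum_ite_eq', Finset.mem_univ, if_true, ih]
    split_ifs
    · rw [Finset.mul_sum]
      exact Finset.sum_congr rfl fun ρ _ => by ring
    · simp

theorem prod_Cminus_snoc_zero_right {N : ℕ} (η : ℂ) (lam : Fin (N + 1) → ℂ) (ξm : ℂ) (l : List ℂ)
    (σ τ : Config N) (i : Fin 2) :
    (l.map (Cminus η lam ξm)).prod (Fin.snoc σ i) (Fin.snoc τ 0) =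
      if i = 0 then (l.map fun u => Complex.sinh (u - lam (Fin.last N)) *
          Complex.sinh (u + lam (Fin.last N) + η)).prod *
        (l.map (Cminus η (Fin.init lam) ξm)).prod σ τ else 0 := by
  induction l generalizing σ i with
  | nil => simp [Matrix.one_apply, Fin.snoc_inj, ite_and]; split_ifs <;> rfl
  | cons u l ih =>
    simp only [List.map_cons, List.prod_cons, Matrix.mul_apply, sum_config_succ, ih, mul_ite,
      mul_zero, Finset.sum_ite_eq', Finset.mem_univ, if_true, Cminus_snoc_zero_right]
    split_ifs
    · rw [Finset.mul_sum]
      exact Finset.sum_congr rfl fun ρ _ => by ring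
    · simp

theorem partitionZ_eq_prod_map {N : ℕ} (η : ℂ) (xi lam : Fin N → ℂ) (ξm : ℂ) :
    partitionZ η xi lam ξm =
      ((List.ofFn xi).map (Cminus η lam ξm)).prod (fun _ => 0) (fun _ => 1) := by
  rw [List.map_ofFn]; rfl

/-- If the last vertical parameter equals the first horizontal one, the first double row and the
last column are frozen. -/
theorem partitionZ_cons_snoc {N : ℕ} (η x : ℂ) (xi lam : Fin N → ℂ) (ξm : ℂ) :
    partitionZ η (Fin.cons x xi) (Fin.snoc lam x) ξm =
      Complex.sinh η * Complex.sinh (2 * x) * Complex.sinh (x + ξm) *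
        (∏ k, Complex.sinh (x - lam k + η) * Complex.sinh (x + lam k + η)) *
        (∏ a, Complex.sinh (xi a - x + η) * Complex.sinh (xi a + x)) *
        partitionZ η xi lam ξm := by
  rw [partitionZ_eq_prod_map, partitionZ_eq_prod_map, List.ofFn_cons, List.map_cons,
    List.prod_cons, Matrix.mul_apply, sum_config_succ, const_eq_snoc, const_eq_snoc]
  simp only [prod_Cminus_snoc_one_left, Fin.sum_univ_two, Cminus_snoc_zero_zero,
    Cminus_snoc_zero_one, Fin.snoc_last, Fin.init_snoc, sub_self, Complex.sinh_zero, zero_mul,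
    add_zero, zero_add, if_true, (boundaryMonodromy_up _ _ _ _ _).2]
  rw [Finset.sum_eq_single (fun _ => 0)]
  · rw [if_pos rfl, List.map_ofFn, List.prod_ofFn, two_mul]
    simp only [Function.comp_apply]
    ring
  · intro ρ _ hρ
    rw [if_neg hρ]; simp
  · simp

/-- If the last vertical parameter is the opposite of the last horizontal one, the last double row
and the last column are frozen. -/
theorem partitionZ_snoc_snoc_neg {N : ℕ} (η x : ℂ) (xi lam : Fin N → ℂ) (ξm : ℂ) :
    partitionZ η (Fin.snoc xi x) (Fin.snoc lam (-x)) ξm =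
      Complex.sinh η * Complex.sinh (2 * x) * Complex.sinh (-x + ξm) *
        (∏ k, Complex.sinh (x - lam k + η) * Complex.sinh (x + lam k + η)) *
        (∏ a, Complex.sinh (xi a - x + η) * Complex.sinh (xi a + x)) *
        partitionZ η xi lam ξm := by
  have hl : List.ofFn (Fin.snoc xi x : Fin (N + 1) → ℂ) = List.ofFn xi ++ [x] := by
    rw [List.ofFn_succ_last]; simp
  rw [partitionZ_eq_prod_map, partitionZ_eq_prod_map, hl, List.map_append,
    List.prod_append, Matrix.mul_apply, sum_config_succ, const_eq_snoc, const_eq_snoc]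
  simp only [List.map_cons, List.map_nil, List.prod_singleton, Fin.sum_univ_two,
    Cminus_snoc_one_one, Cminus_snoc_zero_one, Fin.snoc_last, Fin.init_snoc,
    prod_Cminus_snoc_zero_right, add_neg_cancel, Complex.sinh_zero, zero_mul, mul_zero,
    add_zero, zero_add, if_true, (boundaryMonodromy_down _ _ _ _ _).2]
  rw [Finset.sum_eq_single (fun _ => 1)]
  · rw [if_pos rfl, List.map_ofFn, List.prod_ofFn, two_mul, sub_neg_eq_add, neg_add_eq_sub]
    simp only [Function.comp_apply, sub_neg_eq_add]
    have : ∀ a, Complex.sinh (xi a + x) * Complex.sinh (xi a + -x + η) =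
        Complex.sinh (xi a - x + η) * Complex.sinh (xi a + x) := fun a => by
      rw [mul_comm, sub_eq_add_neg]
    simp only [this]
    ring
  · intro ρ _ hρ
    rw [if_neg hρ]; simp
  · simp

/-! ### Two auxiliary spaces -/

section Aux

variable {A B : Type*} [Ring A] [Ring B]

/-- The operator `X ⊗ 1` on two auxiliary spaces. -/
def aux1 (X : Matrix (Fin 2) (Fin 2) A) : Matrix (Fin 2 × Fin 2) (Fin 2 × Fin 2) A :=
  Matrix.of fun p q => if p.2 = q.2 then X p.1 q.1 else 0

/-- The operator `1 ⊗ X` on two auxiliary spaces. -/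
def aux2 (X : Matrix (Fin 2) (Fin 2) A) : Matrix (Fin 2 × Fin 2) (Fin 2 × Fin 2) A :=
  Matrix.of fun p q => if p.1 = q.1 then X p.2 q.2 else 0

theorem aux1_mul (X Y : Matrix (Fin 2) (Fin 2) A) : aux1 (X * Y) = aux1 X * aux1 Y := by
  ext p q
  simp only [aux1, Matrix.mul_apply, Fintype.sum_prod_type, Matrix.of_apply]
  split_ifs <;> simp [*]

theorem aux2_mul (X Y : Matrix (Fin 2) (Fin 2) A) : aux2 (X * Y) = aux2 X * aux2 Y := by
  ext p q
  simp only [aux2, Matrix.mul_apply, Fintype.sum_prod_type_right, Matrix.of_apply]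
  split_ifs <;> simp [*]

theorem aux1_map (f : A →+* B) (X : Matrix (Fin 2) (Fin 2) A) :
    aux1 (X.map f) = (aux1 X).map f := by
  ext p q
  simp only [aux1, Matrix.map_apply, Matrix.of_apply]
  split_ifs <;> simp

theorem aux2_map (f : A →+* B) (X : Matrix (Fin 2) (Fin 2) A) :
    aux2 (X.map f) = (aux2 X).map f := by
  ext p q
  simp only [aux2, Matrix.map_apply, Matrix.of_apply]
  split_ifs <;> simp

theorem aux1_mul_aux2_comm (X Y : Matrix (Fin 2) (Fin 2) A)
    (h : ∀ s t s' t', Commute (X s t) (Y s' t')) : aux1 X * aux2 Y = aux2 Y * aux1 X := by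
  ext p q
  have h' := (h p.1 q.1 p.2 q.2).eq
  simpa [aux1, aux2, Matrix.mul_apply, Fintype.sum_prod_type] using h'

/-- The `R`-matrix on two auxiliary spaces, with scalar entries in an algebra. -/
noncomputable def auxR (A : Type*) [Ring A] [Algebra ℂ A] (η u : ℂ) :
    Matrix (Fin 2 × Fin 2) (Fin 2 × Fin 2) A :=
  (Rmat η u).map (algebraMap ℂ A)

end Aux

/-! ### The Yang-Baxter equation -/

theorem Rmat_swap (η u : ℂ) (s i t j : Fin 2) :
    Rmat η u (i, s) (j, t) = Rmat η u (s, i) (t, j) := by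
  simp only [Rmat_apply]
  fin_cases s <;> fin_cases i <;> fin_cases t <;> fin_cases j <;> simp

set_option maxHeartbeats 4000000 in
/-- The Yang-Baxter equation in components. It reduces to the three relations `h1`, `h2`, `h3`
between the weights. -/
theorem yang_baxter (η p y : ℂ) (s t i s' t' j : Fin 2) :
    ∑ a, ∑ b, ∑ c,
      Rmat η p (s, t) (a, b) * Rmat η (p + y) (a, i) (s', c) * Rmat η y (b, c) (t', j) =
    ∑ a, ∑ b, ∑ c,
      Rmat η y (t, i) (a, b) * Rmat η (p + y) (s, b) (c, j) * Rmat η p (c, a) (s', t') := by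
  have h1 : Complex.sinh (p + η) * Complex.sinh (p + y) =
      Complex.sinh (p + y + η) * Complex.sinh p + Complex.sinh η * Complex.sinh y := by
    simp only [Complex.sinh, neg_add, Complex.exp_add, Complex.exp_neg]
    field_simp
    ring
  have h2 : Complex.sinh (p + η) * Complex.sinh (y + η) =
      Complex.sinh y * Complex.sinh p + Complex.sinh η * Complex.sinh (p + y + η) := by
    simp only [Complex.sinh, neg_add, Complex.exp_add, Complex.exp_neg]
    field_simp
    ring
  have h3 : Complex.sinh (p + y) * Complex.sinh (y + η) =
      Complex.sinh y * Complex.sinh (p + y + η) + Complex.sinh η * Complex.sinh p := by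
    simp only [Complex.sinh, neg_add, Complex.exp_add, Complex.exp_neg]
    field_simp
    ring
  simp only [Rmat_apply, Fin.sum_univ_two]
  generalize Complex.sinh (p + y + η) = a₁ at *
  generalize Complex.sinh (p + η) = a₂ at *
  generalize Complex.sinh (y + η) = a₃ at *
  generalize Complex.sinh (p + y) = b₁ at *
  generalize Complex.sinh p = b₂ at *
  generalize Complex.sinh y = b₃ at *
  generalize Complex.sinh η = c at *
  fin_cases s <;> fin_cases t <;> fin_cases s' <;> fin_cases t' <;> fin_cases i <;> fin_cases j <;>
  simp <;>
  first
    | ring1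
    | linear_combination c * h1
    | linear_combination -c * h1
    | linear_combination c * h2
    | linear_combination -c * h2
    | linear_combination c * h3
    | linear_combination -c * h3


section Products

variable {A : Type*} [Ring A] [Algebra ℂ A] (η u : ℂ) (X Y : Matrix (Fin 2) (Fin 2) A)
  (s t s' t' : Fin 2)

theorem auxR_mul_aux1_mul_aux2_apply :
    (auxR A η u * aux1 X * aux2 Y) (s, t) (s', t') =
      ∑ a, ∑ b, Rmat η u (s, t) (a, b) • (X a s' * Y b t') := by
  simp only [auxR, aux1, aux2, Matrix.mul_apply, Fintype.sum_prod_type, Matrix.map_apply,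
    Matrix.of_apply, mul_ite, mul_zero, Finset.sum_ite_eq', Finset.mem_univ, if_true,
    Finset.sum_ite_irrel, Finset.sum_const_zero, Finset.sum_mul, Algebra.smul_def, mul_assoc]
  exact Finset.sum_comm

theorem aux2_mul_aux1_mul_auxR_apply :
    (aux2 Y * aux1 X * auxR A η u) (s, t) (s', t') =
      ∑ a, ∑ b, Rmat η u (a, b) (s', t') • (Y t b * X s a) := by
  simp only [auxR, aux1, aux2, Matrix.mul_apply, Fintype.sum_prod_type, Matrix.map_apply,
    Matrix.of_apply, mul_ite, ite_mul, zero_mul, mul_zero, Finset.sum_ite_eq, Finset.sum_ite_eq',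
    Finset.mem_univ, if_true, Algebra.smul_def,
    Algebra.commutes]

theorem aux1_mul_auxR_mul_aux2_apply :
    (aux1 X * auxR A η u * aux2 Y) (s, t) (s', t') =
      ∑ a, ∑ b, Rmat η u (a, t) (s', b) • (X s a * Y b t') := by
  simp only [auxR, aux1, aux2, Matrix.mul_apply, Fintype.sum_prod_type, Matrix.map_apply,
    Matrix.of_apply, mul_ite, mul_zero, Finset.sum_ite_eq, Finset.sum_ite_eq',
    Finset.mem_univ, if_true, Finset.sum_ite_irrel, Finset.sum_const_zero, Algebra.smul_def,
    ← Algebra.commutes, Finset.sum_mul, mul_assoc]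
  exact Finset.sum_comm

theorem aux2_mul_auxR_mul_aux1_apply :
    (aux2 Y * auxR A η u * aux1 X) (s, t) (s', t') =
      ∑ a, ∑ b, Rmat η u (s, b) (a, t') • (Y t b * X a s') := by
  simp only [auxR, aux1, aux2, Matrix.mul_apply, Fintype.sum_prod_type, Matrix.map_apply,
    Matrix.of_apply, mul_ite, mul_zero, Finset.sum_ite_eq, Finset.sum_ite_eq',
    Finset.mem_univ, if_true, Finset.sum_ite_irrel, Finset.sum_const_zero, Algebra.smul_def,
    ← Algebra.commutes, Finset.sum_mul, mul_assoc]

end Products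

/-- The `R`-matrix as a `2 × 2` matrix over the operators on its second space. -/
noncomputable def locL (η u : ℂ) : Matrix (Fin 2) (Fin 2) (Matrix (Fin 2) (Fin 2) ℂ) :=
  Matrix.of fun s t => Matrix.of fun i j => Rmat η u (s, i) (t, j)

theorem auxR_mul_locL_mul_locL (η x y : ℂ) :
    auxR _ η (x - y) * aux1 (locL η x) * aux2 (locL η y) =
      aux2 (locL η y) * aux1 (locL η x) * auxR _ η (x - y) := by
  obtain ⟨p, rfl⟩ : ∃ p, x = p + y := ⟨x - y, by ring⟩
  rw [add_sub_cancel_right]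
  ext ⟨s, t⟩ ⟨s', t'⟩ i j
  have h := yang_baxter η p y s t i s' t' j
  rw [auxR_mul_aux1_mul_aux2_apply, aux2_mul_aux1_mul_auxR_apply]
  simp only [locL, Matrix.smul_apply, Matrix.mul_apply, Matrix.of_apply,
    Matrix.add_apply, smul_eq_mul, Fin.sum_univ_two] at h ⊢
  linear_combination h

theorem locL_mul_auxR_mul_locL (η x y : ℂ) :
    aux1 (locL η x) * auxR _ η (x + y) * aux2 (locL η y) =
      aux2 (locL η y) * auxR _ η (x + y) * aux1 (locL η x) := by
  ext ⟨s, t⟩ ⟨s', t'⟩ i j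
  -- the Yang-Baxter equation with the second auxiliary space and the site exchanged
  have h := yang_baxter η x y s i t s' j t'
  simp only [fun a b => Rmat_swap η y a b t' j, fun a b => Rmat_swap η y t i b a] at h
  rw [aux1_mul_auxR_mul_aux2_apply, aux2_mul_auxR_mul_aux1_apply]
  simp only [locL, Matrix.smul_apply, Matrix.mul_apply, Matrix.of_apply,
    Matrix.add_apply, smul_eq_mul, Fin.sum_univ_two] at h ⊢
  linear_combination h

/-! ### The reflection equation -/

section Reflection

variable {A : Type*} [Ring A] [Algebra ℂ A]

/-- The reflection equation between `X` and `Y`, taken at the spectral parameters `u` and `v`. -/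
def Reflection (η u v : ℂ) (X Y : Matrix (Fin 2) (Fin 2) A) : Prop :=
  auxR A η (u - v) * aux1 X * auxR A η (u + v) * aux2 Y =
    aux2 Y * auxR A η (u + v) * aux1 X * auxR A η (u - v)

/-- Sandwiching a pair of solutions between `L`-operators of a new site gives a pair of
solutions. Stated in a monoid: `x`, `y` are the two solutions, `r`, `q` the `R`-matrices of the
difference and the sum, and `l₁`, `m₁`, `l₂`, `m₂` the `L`-operators. -/
theorem dressing_identity {M : Type*} [Monoid M] {x y r q l₁ m₁ l₂ m₂ : M}
    (h : r * x * q * y = y * q * x * r)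
    (hl : r * l₁ * l₂ = l₂ * l₁ * r) (hm : r * m₁ * m₂ = m₂ * m₁ * r)
    (hml : m₁ * q * l₂ = l₂ * q * m₁) (hlm : l₁ * q * m₂ = m₂ * q * l₁)
    (hxl : x * l₂ = l₂ * x) (hxm : x * m₂ = m₂ * x) (hyl : l₁ * y = y * l₁)
    (hym : m₁ * y = y * m₁) :
    r * (l₁ * x * m₁) * q * (l₂ * y * m₂) = (l₂ * y * m₂) * q * (l₁ * x * m₁) * r := by
  calc r * (l₁ * x * m₁) * q * (l₂ * y * m₂)
      = r * l₁ * x * (m₁ * q * l₂) * y * m₂ := by simp only [mul_assoc]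
    _ = r * l₁ * (x * l₂) * q * (m₁ * y) * m₂ := by rw [hml]; simp only [mul_assoc]
    _ = (r * l₁ * l₂) * x * q * y * m₁ * m₂ := by rw [hxl, hym]; simp only [mul_assoc]
    _ = l₂ * l₁ * (r * x * q * y) * m₁ * m₂ := by rw [hl]; simp only [mul_assoc]
    _ = l₂ * (l₁ * y) * q * x * (r * m₁ * m₂) := by rw [h]; simp only [mul_assoc]
    _ = l₂ * y * l₁ * q * (x * m₂) * m₁ * r := by rw [hyl, hm]; simp only [mul_assoc]
    _ = l₂ * y * (l₁ * q * m₂) * x * m₁ * r := by rw [hxm]; simp only [mul_assoc]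
    _ = (l₂ * y * m₂) * q * (l₁ * x * m₁) * r := by rw [hlm]; simp only [mul_assoc]

/-- In a pair of solutions of the reflection equation the lower left entries commute. -/
theorem Reflection.commute_lower_left {η u v : ℂ} {X Y : Matrix (Fin 2) (Fin 2) A}
    (h : Reflection η u v X Y) (h1 : Complex.sinh (u - v + η) ≠ 0)
    (h2 : Complex.sinh (u + v) ≠ 0) : Commute (X 1 0) (Y 1 0) := by
  have hl : ∀ M : Matrix (Fin 2 × Fin 2) (Fin 2 × Fin 2) A,
      (auxR A η (u - v) * M) (1, 1) (0, 0) = Complex.sinh (u - v + η) • M (1, 1) (0, 0) := by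
    intro M
    simp [auxR, Matrix.mul_apply, Fintype.sum_prod_type, Rmat_apply, Algebra.smul_def]
  have hr : ∀ M : Matrix (Fin 2 × Fin 2) (Fin 2 × Fin 2) A,
      (M * auxR A η (u - v)) (1, 1) (0, 0) = Complex.sinh (u - v + η) • M (1, 1) (0, 0) := by
    intro M
    simp [auxR, Matrix.mul_apply, Fintype.sum_prod_type, Rmat_apply, Algebra.smul_def,
      Algebra.commutes]
  have h' := congrFun (congrFun h (1, 1)) (0, 0)
  rw [hr, mul_assoc, mul_assoc, hl, ← mul_assoc, aux1_mul_auxR_mul_aux2_apply,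
    aux2_mul_auxR_mul_aux1_apply] at h'
  change X 1 0 * Y 1 0 = Y 1 0 * X 1 0
  simpa [Rmat_apply, Fin.sum_univ_two, h1, h2] using h'

end Reflection

theorem Rak_eq_map {N : ℕ} (η : ℂ) (k : Fin N) (u : ℂ) :
    Rak η k u = (locL η u).map (siteHom k) := rfl

theorem auxR_map_siteHom {N : ℕ} (η u : ℂ) (k : Fin N) :
    (auxR (Matrix (Fin 2) (Fin 2) ℂ) η u).map (siteHom k) = auxR (QOp N) η u := by
  refine Matrix.ext fun p q => ?_
  simp only [auxR, Matrix.map_apply, Algebra.algebraMap_eq_smul_one]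
  exact siteOp_smul_one k _

theorem auxR_mul_Rak_mul_Rak {N : ℕ} (η x y : ℂ) (k : Fin N) :
    auxR _ η (x - y) * aux1 (Rak η k x) * aux2 (Rak η k y) =
      aux2 (Rak η k y) * aux1 (Rak η k x) * auxR _ η (x - y) := by
  simp only [Rak_eq_map, aux1_map, aux2_map, ← auxR_map_siteHom η _ k, ← Matrix.map_mul,
    auxR_mul_locL_mul_locL]

theorem Rak_mul_auxR_mul_Rak {N : ℕ} (η x y : ℂ) (k : Fin N) :
    aux1 (Rak η k x) * auxR _ η (x + y) * aux2 (Rak η k y) =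
      aux2 (Rak η k y) * auxR _ η (x + y) * aux1 (Rak η k x) := by
  simp only [Rak_eq_map, aux1_map, aux2_map, ← auxR_map_siteHom η _ k, ← Matrix.map_mul,
    locL_mul_auxR_mul_locL]

/-- The boundary monodromy matrix built from the sites of a list. -/
noncomputable def listMonodromy {N : ℕ} (η : ℂ) (lam : Fin N → ℂ) (ξm u : ℂ) (l : List (Fin N)) :
    AuxOp N :=
  (l.map fun k => Rak η k (u - lam k)).reverse.prod * Kminus N ξm u *
    (l.map fun k => Rka η k (u + lam k)).prod

theorem listMonodromy_append_singleton {N : ℕ} (η : ℂ) (lam : Fin N → ℂ) (ξm u : ℂ)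
    (l : List (Fin N)) (k : Fin N) :
    listMonodromy η lam ξm u (l ++ [k]) =
      Rak η k (u - lam k) * listMonodromy η lam ξm u l * Rak η k (u + lam k) := by
  simp [listMonodromy, mul_assoc, Rka_eq_Rak]

theorem listMonodromy_commute {N : ℕ} (η : ℂ) (lam : Fin N → ℂ) (ξm u : ℂ) (l : List (Fin N))
    (k : Fin N) (hk : k ∉ l) (A : Matrix (Fin 2) (Fin 2) ℂ) (s t : Fin 2) :
    Commute (listMonodromy η lam ξm u l s t) (siteOp k A) := by
  induction l using List.reverseRecOn generalizing s t with
  | nil =>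
    simp only [listMonodromy, List.map_nil, List.reverse_nil, List.prod_nil, one_mul, mul_one,
      Kminus, Matrix.of_apply]
    exact (Commute.one_left _).smul_left _
  | append_singleton l m ih =>
    rw [List.mem_append, List.mem_singleton, not_or] at hk
    rw [listMonodromy_append_singleton, Matrix.mul_apply]
    refine Commute.sum_left _ _ _ fun a _ => Commute.mul_left ?_ (siteOp_commute (Ne.symm hk.2) _ _)
    rw [Matrix.mul_apply]
    exact Commute.sum_left _ _ _ fun b _ =>
      Commute.mul_left (siteOp_commute (Ne.symm hk.2) _ _) (ih hk.1 _ _)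

/-- The diagonal `K`-matrix solves the reflection equation. -/
theorem Kminus_reflection (N : ℕ) (η u v ξm : ℂ) :
    Reflection η u v (Kminus N ξm u) (Kminus N ξm v) := by
  have key : Complex.sinh (u - v) * (Complex.sinh (u + ξm) * Complex.sinh (v + ξm) -
      Complex.sinh (ξm - u) * Complex.sinh (ξm - v)) =
      Complex.sinh (u + v) * (Complex.sinh (u + ξm) * Complex.sinh (ξm - v) -
      Complex.sinh (ξm - u) * Complex.sinh (v + ξm)) := by
    simp only [Complex.sinh, sub_eq_add_neg, neg_add, Complex.exp_add, neg_neg, Complex.exp_neg]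
    field_simp
    ring
  have h0 : Reflection η u v (Kmat ξm u) (Kmat ξm v) := by
    ext ⟨s, t⟩ ⟨s', t'⟩
    fin_cases s <;> fin_cases t <;> fin_cases s' <;> fin_cases t' <;>
    simp [auxR, aux1, aux2, Kmat, Rmat_apply, Matrix.mul_apply, Fintype.sum_prod_type,
      Fin.sum_univ_two] <;>
    first
      | ring1
      | linear_combination Complex.sinh η * key
      | linear_combination -Complex.sinh η * key
  have hK : ∀ w, Kminus N ξm w = (Kmat ξm w).map (algebraMap ℂ (QOp N)) := by
    intro w
    ext s t : 2
    simp [Kminus, Algebra.algebraMap_eq_smul_one]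
  have hR : ∀ w, auxR (QOp N) η w = (auxR ℂ η w).map (algebraMap ℂ (QOp N)) := by
    intro w
    ext s t : 2
    simp [auxR]
  simp only [Reflection, hK, hR, aux1_map, aux2_map, ← Matrix.map_mul]
  rw [h0]

theorem listMonodromy_reflection {N : ℕ} (η : ℂ) (lam : Fin N → ℂ) (ξm u v : ℂ)
    (l : List (Fin N)) (hl : l.Nodup) :
    Reflection η u v (listMonodromy η lam ξm u l) (listMonodromy η lam ξm v l) := by
  induction l using List.reverseRecOn with
  | nil => simpa [listMonodromy] using Kminus_reflection N η u v ξm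
  | append_singleton l k ih =>
    have hk : k ∉ l := by
      intro h
      exact (List.disjoint_of_nodup_append hl) h (List.mem_singleton_self k)
    have hc := fun w s t => fun A => listMonodromy_commute η lam ξm w l k hk A s t
    have h1 := auxR_mul_Rak_mul_Rak η (u - lam k) (v - lam k) k
    have h2 := auxR_mul_Rak_mul_Rak η (u + lam k) (v + lam k) k
    have h3 := Rak_mul_auxR_mul_Rak η (u + lam k) (v - lam k) k
    have h4 := Rak_mul_auxR_mul_Rak η (u - lam k) (v + lam k) k
    rw [show u - lam k - (v - lam k) = u - v by ring] at h1
    rw [show u + lam k - (v + lam k) = u - v by ring] at h2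
    rw [show u + lam k + (v - lam k) = u + v by ring] at h3
    rw [show u - lam k + (v + lam k) = u + v by ring] at h4
    simp only [Reflection, listMonodromy_append_singleton, aux1_mul, aux2_mul]
    refine dressing_identity (ih (List.Nodup.of_append_left hl)) h1 h2 h3 h4 ?_ ?_ ?_ ?_
    · exact aux1_mul_aux2_comm _ _ fun s t s' t' => hc u s t _
    · exact aux1_mul_aux2_comm _ _ fun s t s' t' => hc u s t _
    · exact aux1_mul_aux2_comm _ _ fun s t s' t' => (hc v s' t' _).symm
    · exact aux1_mul_aux2_comm _ _ fun s t s' t' => (hc v s' t' _).symm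

theorem boundaryMonodromy_eq_listMonodromy {N : ℕ} (η : ℂ) (lam : Fin N → ℂ) (ξm u : ℂ) :
    boundaryMonodromy η lam ξm u = listMonodromy η lam ξm u (List.finRange N) := by
  simp [boundaryMonodromy, listMonodromy, monodromy, monodromyHat, List.ofFn_eq_map]

/-- The double rows commute, so that the partition function is symmetric in the `ξ_a`. -/
theorem Cminus_commute {N : ℕ} (η : ℂ) (lam : Fin N → ℂ) (ξm u v : ℂ)
    (h1 : Complex.sinh (u - v + η) ≠ 0) (h2 : Complex.sinh (u + v) ≠ 0) :
    Commute (Cminus η lam ξm u) (Cminus η lam ξm v) := by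
  have h := listMonodromy_reflection η lam ξm u v _ (List.nodup_finRange N)
  rw [← boundaryMonodromy_eq_listMonodromy, ← boundaryMonodromy_eq_listMonodromy] at h
  exact h.commute_lower_left h1 h2

/-! ### Trigonometric polynomials -/

section

open Polynomial

/-- `f` is a linear combination of the `m` exponentials `exp (k x)` with
`k = -(m - 1), -(m - 3), …, m - 1`, encoded as `exp (-(m - 1) x) * p (exp (2 x))` with
`deg p < m`. -/
def TrigPoly (m : ℕ) (f : ℂ → ℂ) : Prop :=
  ∃ p : ℂ[X], p.degree < m ∧
    ∀ x, f x * Complex.exp (m * x) = Complex.exp x * p.eval (Complex.exp (2 * x))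

namespace TrigPoly

variable {m n : ℕ} {f g : ℂ → ℂ}

theorem zero (m : ℕ) : TrigPoly m fun _ => 0 :=
  ⟨0, by simp, by simp⟩

theorem const (c : ℂ) : TrigPoly 1 fun _ => c :=
  ⟨C c, degree_C_le.trans_lt (by norm_num), fun x => by simp [mul_comm]⟩

theorem sinh_add (c : ℂ) : TrigPoly 2 fun x => Complex.sinh (x + c) := by
  refine ⟨C (Complex.exp c / 2) * X + C (-Complex.exp (-c) / 2), ?_, fun x => ?_⟩
  · exact degree_linear_le.trans_lt (by norm_num)
  · simp only [Complex.sinh, neg_add, Complex.exp_add, eval_add, eval_mul, eval_C, eval_X]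
    have h : Complex.exp (2 * x) = Complex.exp x * Complex.exp x := by
      rw [← Complex.exp_add, two_mul]
    have h' : Complex.exp (-x) * Complex.exp x = 1 := by
      rw [← Complex.exp_add, neg_add_cancel, Complex.exp_zero]
    push_cast
    rw [h]
    linear_combination -Complex.exp (-c) / 2 * Complex.exp x * h'

theorem add (hf : TrigPoly m f) (hg : TrigPoly m g) : TrigPoly m fun x => f x + g x := by
  obtain ⟨p, hp, hp'⟩ := hf
  obtain ⟨q, hq, hq'⟩ := hg
  refine ⟨p + q, (degree_add_le _ _).trans_lt (max_lt hp hq), fun x => ?_⟩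
  rw [add_mul, hp', hq', eval_add, mul_add]

theorem mul (hf : TrigPoly (m + 1) f) (hg : TrigPoly n g) :
    TrigPoly (m + n) fun x => f x * g x := by
  obtain ⟨p, hp, hp'⟩ := hf
  obtain ⟨q, hq, hq'⟩ := hg
  refine ⟨p * q, ?_, fun x => ?_⟩
  · by_cases hp0 : p = 0
    · simp [hp0]
    by_cases hq0 : q = 0
    · simp [hq0]
    rw [degree_eq_natDegree hp0] at hp
    rw [degree_eq_natDegree hq0] at hq
    rw [degree_mul, degree_eq_natDegree hp0, degree_eq_natDegree hq0]
    norm_cast at hp hq ⊢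
    omega
  · have h := congrArg₂ (· * ·) (hp' x) (hq' x)
    have e : Complex.exp ((m + 1 : ℕ) * x) * Complex.exp (n * x) =
        Complex.exp x * Complex.exp ((m + n : ℕ) * x) := by
      rw [← Complex.exp_add, ← Complex.exp_add]
      congr 1
      push_cast
      ring
    refine mul_left_cancel₀ (Complex.exp_ne_zero x) ?_
    rw [eval_mul]
    linear_combination h - f x * g x * e

theorem const_mul (c : ℂ) (hf : TrigPoly m f) : TrigPoly m fun x => c * f x := by
  simpa using (const c : TrigPoly (0 + 1) _).mul hf

theorem mul_const (c : ℂ) (hf : TrigPoly m f) : TrigPoly m fun x => f x * c := by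
  simpa [mul_comm] using hf.const_mul c

theorem sub (hf : TrigPoly m f) (hg : TrigPoly m g) : TrigPoly m fun x => f x - g x := by
  simpa [sub_eq_add_neg] using hf.add (hg.const_mul (-1))

theorem sinh_sub (c : ℂ) : TrigPoly 2 fun x => Complex.sinh (c - x) := by
  have e : (fun x => Complex.sinh (c - x)) = fun x => -1 * Complex.sinh (x + -c) := by
    funext x
    rw [neg_one_mul, ← Complex.sinh_neg]
    congr 1
    ring
  rw [e]
  exact (sinh_add (-c)).const_mul (-1)

theorem sum {ι : Type*} (s : Finset ι) {F : ι → ℂ → ℂ} (h : ∀ i ∈ s, TrigPoly m (F i)) :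
    TrigPoly m fun x => ∑ i ∈ s, F i x := by
  classical
  induction s using Finset.induction_on with
  | empty => simpa using zero m
  | insert i s hi ih =>
    simp only [Finset.sum_insert hi]
    exact (h i (Finset.mem_insert_self i s)).add
      (ih fun j hj => h j (Finset.mem_insert_of_mem hj))

theorem prod {ι : Type*} (s : Finset ι) {F : ι → ℂ → ℂ} (h : ∀ i ∈ s, TrigPoly (m + 1) (F i)) :
    TrigPoly (s.card * m + 1) fun x => ∏ i ∈ s, F i x := by
  classical
  induction s using Finset.induction_on with
  | empty => simpa using const 1
  | insert i s hi ih =>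
    simp only [Finset.prod_insert hi, Finset.card_insert_of_notMem hi]
    have := (h i (Finset.mem_insert_self i s)).mul
      (ih fun j hj => h j (Finset.mem_insert_of_mem hj))
    rwa [show (s.card + 1) * m + 1 = m + (s.card * m + 1) by ring]

theorem list_prod {α : Type*} (l : List α) {F : α → ℂ → ℂ} (h : ∀ i, TrigPoly (m + 1) (F i)) :
    TrigPoly (l.length * m + 1) fun x => (l.map fun i => F i x).prod := by
  induction l with
  | nil => simpa using const 1
  | cons i l ih =>
    simp only [List.map_cons, List.prod_cons, List.length_cons]
    have := (h i).mul ih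
    rwa [show (l.length + 1) * m + 1 = m + (l.length * m + 1) by ring]

/-- A trigonometric polynomial with `m` coefficients that vanishes at `m` points, distinct modulo
`π i`, is zero. -/
theorem eq_zero_of_vanish {ι : Type*} [Fintype ι] (hf : TrigPoly (Fintype.card ι) f) (v : ι → ℂ)
    (hv : ∀ i j, i ≠ j → Complex.sinh (v i - v j) ≠ 0) (h0 : ∀ i, f (v i) = 0) (x : ℂ) :
    f x = 0 := by
  obtain ⟨p, hp, hp'⟩ := hf
  have hinj : Function.Injective fun i => Complex.exp (2 * v i) := by
    intro i j hij
    by_contra hne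
    refine hv i j hne ?_
    have e : Complex.exp (v i - v j) = Complex.exp (-(v i - v j)) := by
      have e1 : Complex.exp (v i - v j) = Complex.exp (2 * v i) * Complex.exp (-(v i + v j)) := by
        rw [← Complex.exp_add]; congr 1; ring
      have e2 : Complex.exp (-(v i - v j)) =
          Complex.exp (2 * v j) * Complex.exp (-(v i + v j)) := by
        rw [← Complex.exp_add]; congr 1; ring
      rw [e1, e2]
      simp only at hij
      rw [hij]
    rw [Complex.sinh, e, sub_self, zero_div]
  have hp0 : p = 0 := by
    refine eq_zero_of_degree_lt_of_eval_index_eq_zero Finset.univ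
      (v := fun i => Complex.exp (2 * v i)) hinj.injOn (by simpa using hp) fun i _ => ?_
    have h := hp' (v i)
    rw [h0, zero_mul] at h
    exact (mul_eq_zero.1 h.symm).resolve_left (Complex.exp_ne_zero _)
  have h := hp' x
  rw [hp0, eval_zero, mul_zero] at h
  exact (mul_eq_zero.1 h).resolve_right (Complex.exp_ne_zero _)

end TrigPoly

end

/-- Each of the `n` double rows crosses the last column twice, which would give degree `2 n` in
`exp x`. The column turns its spin from up to down, so an odd number of its vertices have the
constant weight `sinh η`, and the degree drops to `2 n - 1`. -/
theorem trigPoly_prod_Cminus {N : ℕ} (η : ℂ) (lam : Fin N → ℂ) (ξm : ℂ) (l : List ℂ)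
    (σ τ : Config N) :
    TrigPoly (2 * l.length) fun x =>
      (l.map (Cminus η (Fin.snoc lam x) ξm)).prod (Fin.snoc σ 0) (Fin.snoc τ 1) := by
  induction l generalizing σ with
  | nil => simpa [Matrix.one_apply, Fin.snoc_inj] using TrigPoly.zero 0
  | cons u l ih =>
    simp only [List.map_cons, List.prod_cons, Matrix.mul_apply, sum_config_succ, Fin.sum_univ_two,
      List.length_cons, prod_Cminus_snoc_one_left, Cminus_snoc_zero_zero, Cminus_snoc_zero_one,
      Fin.snoc_last, Fin.init_snoc, if_true]
    have hs : ∀ c, TrigPoly (1 + 1) fun x => Complex.sinh (c - x) := TrigPoly.sinh_sub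
    have ha : ∀ c, TrigPoly (1 + 1) fun x => Complex.sinh (c + x) := by
      simpa [add_comm] using TrigPoly.sinh_add
    have ha' : ∀ c, TrigPoly (1 + 1) fun x => Complex.sinh (c + x + η) := by
      intro c; simpa [add_right_comm] using ha (c + η)
    have hs' : ∀ c, TrigPoly (1 + 1) fun x => Complex.sinh (c - x + η) := by
      intro c; simpa [sub_add_eq_add_sub] using hs (c + η)
    refine TrigPoly.sum _ fun ρ _ => TrigPoly.add ?_ ?_
    · have h1 : TrigPoly (2 + 1) fun x => Complex.sinh (u - x) * Complex.sinh (u + x + η) :=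
        (hs u).mul (ha' u)
      have := (h1.mul_const (Cminus η lam ξm u σ ρ)).mul (ih ρ)
      rwa [show 2 * (l.length + 1) = 2 + 2 * l.length by ring]
    · have h1 : TrigPoly (l.length * 2 + 1) fun x => (l.map fun w =>
          Complex.sinh (w - x + η) * Complex.sinh (w + x)).prod :=
        TrigPoly.list_prod (m := 2) l
          (F := fun w x => Complex.sinh (w - x + η) * Complex.sinh (w + x))
          fun w => (hs' w).mul (ha w)
      have h2 := ((((ha u).mul_const (boundaryMonodromy η lam ξm u 0 0 σ ρ)).add
        ((hs u).mul_const (boundaryMonodromy η lam ξm u 1 1 σ ρ))).const_mul (Complex.sinh η)).mul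
        (h1.mul_const ((l.map (Cminus η lam ξm)).prod ρ τ))
      rwa [show 2 * (l.length + 1) = 1 + (l.length * 2 + 1) by ring]

theorem trigPoly_partitionZ {N : ℕ} (η : ℂ) (xi : Fin (N + 1) → ℂ) (lam : Fin N → ℂ) (ξm : ℂ) :
    TrigPoly (2 * (N + 1)) fun x => partitionZ η xi (Fin.snoc lam x) ξm := by
  simp only [partitionZ_eq_prod_map, const_eq_snoc]
  simpa using trigPoly_prod_Cminus η lam ξm (List.ofFn xi) (fun _ => 0) (fun _ => 1)

/-! ### The determinant formula for the inhomogeneous partition function -/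

theorem det_vandermonde_cons {N : ℕ} (x : ℂ) (v : Fin N → ℂ) :
    (vandermonde (Fin.cons x v : Fin (N + 1) → ℂ)).det =
      (∏ a, (v a - x)) * (vandermonde v).det := by
  rw [det_vandermonde, det_vandermonde, Fin.prod_univ_succ, Fin.prod_Ioi_zero]
  simp only [Fin.prod_Ioi_succ, Fin.cons_zero, Fin.cons_succ]

theorem det_vandermonde_snoc {N : ℕ} (x : ℂ) (v : Fin N → ℂ) :
    (vandermonde (Fin.snoc v x : Fin (N + 1) → ℂ)).det =
      (∏ a, (x - v a)) * (vandermonde v).det := by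
  have h : ∀ {M : ℕ} (w : Fin M → ℂ),
      (vandermonde w).det = ∏ j, ∏ i ∈ Finset.Iio j, (w j - w i) := by
    intro M w
    rw [det_vandermonde]
    exact Finset.prod_comm' (by simp)
  rw [h, h, Fin.prod_univ_castSucc, Fin.Iio_last_eq_map, Finset.prod_map, mul_comm]
  simp only [Fin.prod_Iio_castSucc, Fin.coe_castSuccEmb, Fin.snoc_last, Fin.snoc_castSucc]

/-- The weight attached to the crossing of a double row and a column. -/
noncomputable def crossWeight (η x l : ℂ) : ℂ :=
  Complex.sinh (x + l + η) * Complex.sinh (x - l) * (Complex.sinh (x + l) *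
    Complex.sinh (x - l + η))

theorem crossWeight_neg (η x l : ℂ) : crossWeight η x (-l) = crossWeight η x l := by
  simp only [crossWeight, sub_neg_eq_add, ← sub_eq_add_neg]
  ring

theorem crossWeight_self (η x : ℂ) : crossWeight η x x = 0 := by
  simp [crossWeight]

/-- The matrix with entries `∏_{c ≠ a} w(ξ_c, λ_b)`, which is `1 / w(ξ_a, λ_b)` up to a factor
depending only on the column. -/
noncomputable def weightMatrix {N : ℕ} (η : ℂ) (xi lam : Fin N → ℂ) : Matrix (Fin N) (Fin N) ℂ :=
  Matrix.of fun a b => ∏ c ∈ Finset.univ.erase a, crossWeight η (xi c) (lam b)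

/-- The variable `cosh (2 ξ + η) / 2` of a double row. -/
noncomputable def rowVar (η : ℂ) (x : ℂ) : ℂ := Complex.cosh (2 * x + η) / 2

/-- The variable `-cosh (2 λ) / 2` of a column. -/
noncomputable def colVar (l : ℂ) : ℂ := -(Complex.cosh (2 * l) / 2)

theorem rowVar_sub (η x y : ℂ) :
    rowVar η x - rowVar η y = Complex.sinh (x + y + η) * Complex.sinh (x - y) := by
  have h1 : 2 * x + η = (x + y + η) + (x - y) := by ring
  have h2 : 2 * y + η = (x + y + η) - (x - y) := by ring
  rw [rowVar, rowVar, h1, h2, Complex.cosh_add (x + y + η),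
    Complex.cosh_sub (x + y + η)]
  ring

theorem colVar_sub (x y : ℂ) :
    colVar x - colVar y = Complex.sinh (y + x) * Complex.sinh (y - x) := by
  have h1 : 2 * y = (y + x) + (y - x) := by ring
  have h2 : 2 * x = (y + x) - (y - x) := by ring
  rw [colVar, colVar, h1, h2, Complex.cosh_add (y + x), Complex.cosh_sub (y + x)]
  ring

/-- The determinant formula with all denominators cleared. -/
def DetFormula {N : ℕ} (η ξm : ℂ) (xi lam : Fin N → ℂ) : Prop :=
  partitionZ η xi lam ξm * (vandermonde (rowVar η ∘ xi)).det * (vandermonde (colVar ∘ lam)).det =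
    (∏ a, Complex.sinh η * Complex.sinh (2 * xi a)) * (∏ b, Complex.sinh (lam b + ξm)) *
      (weightMatrix η xi lam).det

/-- The partition function depends only on the multiset of the horizontal parameters. -/
theorem partitionZ_eq_of_perm {N : ℕ} {η : ℂ} {xi xi' : Fin N → ℂ} (lam : Fin N → ℂ) (ξm : ℂ)
    (hp : (List.ofFn xi').Perm (List.ofFn xi))
    (h1 : ∀ a b, a ≠ b → Complex.sinh (xi a - xi b + η) ≠ 0)
    (h2 : ∀ a b, Complex.sinh (xi a + xi b) ≠ 0) :
    partitionZ η xi' lam ξm = partitionZ η xi lam ξm := by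
  rw [partitionZ_eq_prod_map, partitionZ_eq_prod_map]
  have h := (hp.map (Cminus η lam ξm)).symm
  rw [h.prod_eq' ?_]
  rw [List.pairwise_map, List.pairwise_ofFn]
  exact fun a b hab => Cminus_commute η lam ξm _ _ (h1 a b hab.ne) (h2 a b)

theorem weightMatrix_comp_perm {N : ℕ} (η : ℂ) (xi lam : Fin N → ℂ) (π : Equiv.Perm (Fin N)) :
    weightMatrix η (xi ∘ π) lam = (weightMatrix η xi lam).submatrix π id := by
  ext a b
  simp only [weightMatrix, Matrix.of_apply, Matrix.submatrix_apply, id_eq, Function.comp_apply]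
  refine Finset.prod_bij (fun c _ => π c) ?_ ?_ ?_ ?_
  · simp
  · simp
  · intro c hc
    exact ⟨π.symm c, by simpa [Equiv.symm_apply_eq] using hc, by simp⟩
  · simp

theorem detFormula_of_perm {N : ℕ} {η ξm : ℂ} {xi lam : Fin N → ℂ} (π : Equiv.Perm (Fin N))
    (h1 : ∀ a b, a ≠ b → Complex.sinh (xi a - xi b + η) ≠ 0)
    (h2 : ∀ a b, Complex.sinh (xi a + xi b) ≠ 0) (h : DetFormula η ξm (xi ∘ π) lam) :
    DetFormula η ξm xi lam := by
  have hZ := partitionZ_eq_of_perm lam ξm (π.ofFn_comp_perm xi) h1 h2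
  have hV : vandermonde (rowVar η ∘ xi ∘ π) = (vandermonde (rowVar η ∘ xi)).submatrix π id := by
    ext; simp [vandermonde_apply]
  have hs : ((Equiv.Perm.sign π : ℤ) : ℂ) ≠ 0 := by
    exact_mod_cast (Equiv.Perm.sign π).ne_zero
  have hP : ∏ a, Complex.sinh η * Complex.sinh (2 * (xi ∘ π) a) =
      ∏ a, Complex.sinh η * Complex.sinh (2 * xi a) :=
    Equiv.prod_comp π fun a => Complex.sinh η * Complex.sinh (2 * xi a)
  rw [DetFormula, hZ, hV, hP, weightMatrix_comp_perm, det_permute, det_permute] at h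
  rw [DetFormula]
  refine mul_left_cancel₀ hs ?_
  linear_combination h

/-- The Laplace expansion of `weightMatrix` at `λ_last = ± ξ_first` has a single term. -/
theorem det_weightMatrix_cons_snoc {N : ℕ} (η x l : ℂ) (xi lam : Fin N → ℂ)
    (hl : crossWeight η x l = 0) :
    (weightMatrix η (Fin.cons x xi : Fin (N + 1) → ℂ) (Fin.snoc lam l : Fin (N + 1) → ℂ)).det =
      (-1) ^ N * (∏ a, crossWeight η (xi a) l) * (∏ b, crossWeight η x (lam b)) *
        (weightMatrix η xi lam).det := by
  have herase : ∀ (F : Fin (N + 1) → ℂ) (a : Fin N), ∏ c ∈ Finset.univ.erase a.succ, F c =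
      F 0 * ∏ c ∈ Finset.univ.erase a, F c.succ := by
    intro F a
    have : (Finset.univ.erase a.succ : Finset (Fin (N + 1))) =
        Finset.cons 0 ((Finset.univ.erase a).map (Fin.succEmb N)) (by simp [Fin.succ_ne_zero]) := by
      ext c
      refine Fin.cases ?_ (fun c => ?_) c <;> simp [(Fin.succ_ne_zero _).symm, Fin.succ_ne_zero]
    rw [this, Finset.prod_cons, Finset.prod_map]
    rfl
  have herase0 : ∀ F : Fin (N + 1) → ℂ, ∏ c ∈ Finset.univ.erase 0, F c = ∏ c, F (Fin.succ c) := by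
    intro F
    have : (Finset.univ.erase 0 : Finset (Fin (N + 1))) = Finset.univ.map (Fin.succEmb N) := by
      ext c
      refine Fin.cases ?_ (fun c => ?_) c <;> simp [Fin.succ_ne_zero]
    rw [this, Finset.prod_map]
    rfl
  rw [det_succ_column _ (Fin.last N), Fin.sum_univ_succ, Finset.sum_eq_zero, add_zero]
  · have hsub : (weightMatrix η (Fin.cons x xi : Fin (N + 1) → ℂ)
        (Fin.snoc lam l : Fin (N + 1) → ℂ)).submatrix (Fin.succAbove 0)
          (Fin.succAbove (Fin.last N)) =
        Matrix.of fun a b => crossWeight η x (lam b) * weightMatrix η xi lam a b := by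
      ext a b
      simp [weightMatrix, herase]
    rw [hsub, det_mul_row]
    simp [weightMatrix, herase0]
    ring
  · intro a _
    simp [weightMatrix, herase, hl]

theorem comp_fin_cons {N : ℕ} (f : ℂ → ℂ) (x : ℂ) (v : Fin N → ℂ) :
    f ∘ (Fin.cons x v : Fin (N + 1) → ℂ) = Fin.cons (f x) (f ∘ v) := by
  funext a
  refine Fin.cases ?_ (fun a => ?_) a <;> simp

theorem comp_fin_snoc {N : ℕ} (f : ℂ → ℂ) (x : ℂ) (v : Fin N → ℂ) :
    f ∘ (Fin.snoc v x : Fin (N + 1) → ℂ) = Fin.snoc (f ∘ v) (f x) := by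
  funext a
  refine Fin.lastCases ?_ (fun a => ?_) a <;> simp

/-- The induction step of the determinant formula at `λ_last = ± ξ_first`, where both sides
factorize. -/
theorem detFormula_cons_snoc {N : ℕ} {η ξm x l : ℂ} {xi lam : Fin N → ℂ} (hl : l = x ∨ l = -x)
    (h : DetFormula η ξm xi lam)
    (hZ : partitionZ η (Fin.cons x xi) (Fin.snoc lam l) ξm =
      Complex.sinh η * Complex.sinh (2 * x) * Complex.sinh (l + ξm) *
        (∏ k, Complex.sinh (x - lam k + η) * Complex.sinh (x + lam k + η)) *
        (∏ a, Complex.sinh (xi a - x + η) * Complex.sinh (xi a + x)) *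
        partitionZ η xi lam ξm) :
    DetFormula η ξm (Fin.cons x xi : Fin (N + 1) → ℂ) (Fin.snoc lam l : Fin (N + 1) → ℂ) := by
  have hw : ∀ y, crossWeight η y l = crossWeight η y x := by
    rcases hl with rfl | rfl
    · exact fun _ => rfl
    · exact fun y => crossWeight_neg η y x
  have hc : colVar l = colVar x := by
    rcases hl with rfl | rfl <;> simp [colVar]
  have e1 : (∏ a, Complex.sinh (xi a - x + η) * Complex.sinh (xi a + x)) *
      ∏ a, ((rowVar η ∘ xi) a - rowVar η x) = ∏ a, crossWeight η (xi a) x := by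
    rw [← Finset.prod_mul_distrib]
    refine Finset.prod_congr rfl fun a _ => ?_
    rw [Function.comp_apply, rowVar_sub, crossWeight]
    ring
  have e2 : (∏ k, Complex.sinh (x - lam k + η) * Complex.sinh (x + lam k + η)) *
      ∏ b, (colVar x - (colVar ∘ lam) b) = (-1) ^ N * ∏ b, crossWeight η x (lam b) := by
    have hN : ((-1 : ℂ)) ^ N = ∏ _b : Fin N, (-1 : ℂ) := by simp
    rw [← Finset.prod_mul_distrib, hN, ← Finset.prod_mul_distrib]
    refine Finset.prod_congr rfl fun b _ => ?_
    rw [Function.comp_apply, colVar_sub, crossWeight, ← neg_sub x (lam b), Complex.sinh_neg,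
      add_comm (lam b) x]
    ring
  rw [DetFormula] at h ⊢
  rw [hZ, comp_fin_cons, comp_fin_snoc, det_vandermonde_cons, det_vandermonde_snoc,
    det_weightMatrix_cons_snoc _ _ _ _ _ (by rw [hw, crossWeight_self]), Fin.prod_univ_succ,
    Fin.prod_univ_castSucc, hc]
  simp only [Fin.cons_zero, Fin.cons_succ, Fin.snoc_last, Fin.snoc_castSucc, hw]
  rw [← e1]
  linear_combination (Complex.sinh η * Complex.sinh (2 * x) * Complex.sinh (l + ξm)) *
      ((∏ a, Complex.sinh (xi a - x + η) * Complex.sinh (xi a + x)) *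
      ∏ a, ((rowVar η ∘ xi) a - rowVar η x)) * (
      ((∏ k, Complex.sinh (x - lam k + η) * Complex.sinh (x + lam k + η)) *
      ∏ b, (colVar x - (colVar ∘ lam) b)) * h +
      (∏ a, Complex.sinh η * Complex.sinh (2 * xi a)) * (∏ b, Complex.sinh (lam b + ξm)) *
      (weightMatrix η xi lam).det * e2)

theorem trigPoly_crossWeight (η y : ℂ) : TrigPoly (4 + 1) fun x => crossWeight η y x := by
  have hs : ∀ c, TrigPoly (1 + 1) fun x => Complex.sinh (c - x) := TrigPoly.sinh_sub
  have ha : ∀ c, TrigPoly (1 + 1) fun x => Complex.sinh (c + x) := by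
    simpa [add_comm] using TrigPoly.sinh_add
  have ha' : TrigPoly (1 + 1) fun x => Complex.sinh (y + x + η) := by
    simpa [add_right_comm] using ha (y + η)
  have hs' : TrigPoly (1 + 1) fun x => Complex.sinh (y - x + η) := by
    simpa [sub_add_eq_add_sub] using hs (y + η)
  have h1 : TrigPoly (2 + 1) fun x => Complex.sinh (y + x + η) * Complex.sinh (y - x) :=
    ha'.mul (hs y)
  have h2 : TrigPoly (2 + 1) fun x => Complex.sinh (y + x) * Complex.sinh (y - x + η) :=
    (ha y).mul hs'
  exact h1.mul h2

theorem trigPoly_det_weightMatrix {N : ℕ} (η : ℂ) (xi : Fin (N + 1) → ℂ) (lam : Fin N → ℂ) :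
    TrigPoly (N * 4 + 1) fun x =>
      (weightMatrix η xi (Fin.snoc lam x : Fin (N + 1) → ℂ)).det := by
  simp only [det_succ_column _ (Fin.last N)]
  refine TrigPoly.sum _ fun a _ => ?_
  have hsub : ∀ x, (weightMatrix η xi (Fin.snoc lam x : Fin (N + 1) → ℂ)).submatrix a.succAbove
      (Fin.last N).succAbove = Matrix.of fun i j =>
        ∏ c ∈ Finset.univ.erase (a.succAbove i), crossWeight η (xi c) (lam j) := by
    intro x
    ext i j
    simp [weightMatrix]
  simp only [hsub]
  refine TrigPoly.mul_const _ (TrigPoly.const_mul _ ?_)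
  have h := TrigPoly.prod (Finset.univ.erase a) fun c _ => trigPoly_crossWeight η (xi c)
  rw [Finset.card_erase_of_mem (Finset.mem_univ a), Finset.card_univ, Fintype.card_fin,
    Nat.succ_sub_one] at h
  simpa [weightMatrix] using h

/-- At `λ_last = ± λ_b` with `b` another column, both sides of the determinant formula vanish. -/
theorem detFormula_of_coincidence {N : ℕ} {η ξm l : ℂ} (xi : Fin (N + 1) → ℂ) (lam : Fin N → ℂ)
    (b : Fin N) (hl : l = lam b ∨ l = -lam b) :
    DetFormula η ξm xi (Fin.snoc lam l : Fin (N + 1) → ℂ) := by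
  have hdet : (weightMatrix η xi (Fin.snoc lam l : Fin (N + 1) → ℂ)).det = 0 := by
    refine det_zero_of_column_eq (Fin.castSucc_ne_last b) fun a => ?_
    simp only [weightMatrix, Matrix.of_apply, Fin.snoc_castSucc, Fin.snoc_last]
    rcases hl with rfl | rfl
    · rfl
    · simp only [crossWeight_neg]
  have hv : (vandermonde (colVar ∘ (Fin.snoc lam l : Fin (N + 1) → ℂ))).det = 0 := by
    rw [comp_fin_snoc, det_vandermonde_snoc, Finset.prod_eq_zero (Finset.mem_univ b), zero_mul]
    rw [Function.comp_apply, colVar_sub]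
    rcases hl with rfl | rfl <;> simp
  rw [DetFormula, hdet, hv, mul_zero, mul_zero]

/-- Both sides of the determinant formula are trigonometric polynomials in the last vertical
parameter. They agree at `± ξ_a` by freezing and vanish at `± λ_b`, which are as many points as
there are coefficients. -/
theorem detFormula {N : ℕ} (η ξm : ℂ) (xi lam : Fin N → ℂ)
    (h1 : ∀ a b, a ≠ b → Complex.sinh (xi a - xi b + η) ≠ 0)
    (h2 : ∀ i j, Complex.sinh (Sum.elim xi lam i + Sum.elim xi lam j) ≠ 0)
    (h3 : ∀ i j, i ≠ j → Complex.sinh (Sum.elim xi lam i - Sum.elim xi lam j) ≠ 0) :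
    DetFormula η ξm xi lam := by
  induction N with
  | zero =>
    have h : (fun _ => 0 : Config 0) = fun _ => 1 := Subsingleton.elim _ _
    simp [DetFormula, partitionZ, h]
  | succ N ih =>
    obtain ⟨lam, l, rfl⟩ : ∃ (lam' : Fin N → ℂ) (l : ℂ), lam = Fin.snoc lam' l :=
      ⟨Fin.init lam, lam (Fin.last N), (Fin.snoc_init_self lam).symm⟩
    set z : Fin (N + 1) ⊕ Fin N → ℂ := Sum.elim xi lam with hz
    have hzc : ∀ i, z i = Sum.elim xi (Fin.snoc lam l : Fin (N + 1) → ℂ)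
        (Sum.map id Fin.castSucc i) := by
      rintro (a | b) <;> simp [hz]
    have hinj : Function.Injective (Sum.map id Fin.castSucc : Fin (N + 1) ⊕ Fin N → _) :=
      Sum.map_injective.2 ⟨Function.injective_id, Fin.castSucc_injective N⟩
    have g2 : ∀ i j, Complex.sinh (z i + z j) ≠ 0 := fun i j => by
      rw [hzc, hzc]; exact h2 _ _
    have g3 : ∀ i j, i ≠ j → Complex.sinh (z i - z j) ≠ 0 := fun i j hij => by
      rw [hzc, hzc]; exact h3 _ _ (hinj.ne hij)
    have hxi : ∀ a b, Complex.sinh (xi a + xi b) ≠ 0 := fun a b => h2 (Sum.inl a) (Sum.inl b)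
    -- the formula at the interpolation points `± ξ_a`
    have hfreeze : ∀ a x, x = xi a ∨ x = -xi a →
        DetFormula η ξm xi (Fin.snoc lam x : Fin (N + 1) → ℂ) := by
      intro a x hx
      have hcons : xi ∘ a.cycleRange.symm = Fin.cons (xi a) (a.removeNth xi) :=
        (Fin.cons_removeNth_eq_comp_cycleRange_symm _ _).symm
      refine detFormula_of_perm a.cycleRange.symm h1 hxi ?_
      rw [hcons]
      have hIH : DetFormula η ξm (a.removeNth xi) lam := by
        have hzr : ∀ i, Sum.elim (a.removeNth xi) lam i = z (Sum.map a.succAbove id i) := by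
          rintro (b | b) <;> simp [hz, Fin.removeNth]
        have hinj' : Function.Injective (Sum.map a.succAbove id : Fin N ⊕ Fin N → _) :=
          Sum.map_injective.2 ⟨Fin.succAbove_right_injective, Function.injective_id⟩
        refine ih _ _ (fun b c hbc => h1 _ _ (Fin.succAbove_right_injective.ne hbc)) ?_ ?_
        · intro i j; rw [hzr, hzr]; exact g2 _ _
        · intro i j hij; rw [hzr, hzr]; exact g3 _ _ (hinj'.ne hij)
      refine detFormula_cons_snoc hx hIH ?_
      rcases hx with rfl | rfl
      · exact partitionZ_cons_snoc _ _ _ _ _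
      · rw [← partitionZ_snoc_snoc_neg]
        have hp : (List.ofFn (Fin.cons (xi a) (a.removeNth xi) : Fin (N + 1) → ℂ)).Perm
            (List.ofFn xi) := by
          rw [← hcons]; exact Equiv.Perm.ofFn_comp_perm _ _
        have hp' : (List.ofFn (Fin.snoc (a.removeNth xi) (xi a) : Fin (N + 1) → ℂ)).Perm
            (List.ofFn xi) := by
          refine List.Perm.trans ?_ hp
          rw [List.ofFn_cons, List.ofFn_succ_last]
          simp
        rw [partitionZ_eq_of_perm _ _ hp h1 hxi, partitionZ_eq_of_perm _ _ hp' h1 hxi]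
    -- both sides as functions of the last vertical parameter
    let F : ℂ → ℂ := fun x => partitionZ η xi (Fin.snoc lam x) ξm *
      (vandermonde (rowVar η ∘ xi)).det *
      (vandermonde (colVar ∘ (Fin.snoc lam x : Fin (N + 1) → ℂ))).det
    let G : ℂ → ℂ := fun x => (∏ a, Complex.sinh η * Complex.sinh (2 * xi a)) *
      (∏ b, Complex.sinh ((Fin.snoc lam x : Fin (N + 1) → ℂ) b + ξm)) *
      (weightMatrix η xi (Fin.snoc lam x : Fin (N + 1) → ℂ)).det
    have hcard : Fintype.card ((Fin (N + 1) ⊕ Fin N) ⊕ (Fin (N + 1) ⊕ Fin N)) =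
        (2 * N + 1) + (N * 2 + 1) := by
      simp; ring
    have hF : TrigPoly ((2 * N + 1) + (N * 2 + 1)) F := by
      refine TrigPoly.mul (TrigPoly.mul_const _ (trigPoly_partitionZ η xi lam ξm)) ?_
      simp only [comp_fin_snoc, det_vandermonde_snoc, Function.comp_apply, colVar_sub]
      refine TrigPoly.mul_const _ ?_
      have h := TrigPoly.prod (m := 2) Finset.univ
        (F := fun b x => Complex.sinh (lam b + x) * Complex.sinh (lam b - x)) fun b _ => by
          refine TrigPoly.mul (m := 1) (n := 2) ?_ (TrigPoly.sinh_sub _)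
          simpa [add_comm] using TrigPoly.sinh_add (lam b)
      simpa using h
    have hG : TrigPoly ((2 * N + 1) + (N * 2 + 1)) G := by
      rw [show (2 * N + 1) + (N * 2 + 1) = 1 + (N * 4 + 1) by ring]
      refine TrigPoly.mul (TrigPoly.const_mul _ ?_) (trigPoly_det_weightMatrix η xi lam)
      simp only [Fin.prod_univ_castSucc, Fin.snoc_castSucc, Fin.snoc_last]
      exact TrigPoly.const_mul _ (TrigPoly.sinh_add ξm)
    have hFG : TrigPoly (Fintype.card ((Fin (N + 1) ⊕ Fin N) ⊕ (Fin (N + 1) ⊕ Fin N)))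
        fun x => F x - G x := by
      rw [hcard]
      exact hF.sub hG
    refine sub_eq_zero.1 (hFG.eq_zero_of_vanish (Sum.elim z fun i => -z i) ?_ ?_ l)
    · rintro (i | i) (j | j) hij
      · exact g3 i j fun h => hij (congrArg _ h)
      · simpa using g2 i j
      · have := g2 i j
        simp only [Sum.elim_inr, Sum.elim_inl]
        rwa [← neg_add', Complex.sinh_neg, neg_ne_zero]
      · have := g3 j i fun h => hij (congrArg _ h.symm)
        simpa [neg_add_eq_sub] using this
    · rintro ((a | b) | (a | b))
      · exact sub_eq_zero.2 (hfreeze a _ (Or.inl rfl))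
      · exact sub_eq_zero.2 (detFormula_of_coincidence xi lam b (Or.inl rfl))
      · exact sub_eq_zero.2 (hfreeze a _ (Or.inr rfl))
      · exact sub_eq_zero.2 (detFormula_of_coincidence xi lam b (Or.inr rfl))

/-! ### Cauchy determinants -/

section

open Polynomial

/-- The Cauchy determinant. The matrix with entries `∏_{j ≠ b} (y_a - u_j)` is the Vandermonde
matrix of `y` times a matrix independent of `y`, and it is diagonal for `y = u`. -/
theorem det_cauchy {N : ℕ} (y u : Fin N → ℂ) (hu : Function.Injective u)
    (hyu : ∀ a b, y a - u b ≠ 0) :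
    (Matrix.of fun a b => (y a - u b)⁻¹).det =
      (vandermonde y).det * (vandermonde fun b => -u b).det / ∏ a, ∏ b, (y a - u b) := by
  let q : Fin N → ℂ[X] := fun b => ∏ j ∈ Finset.univ.erase b, (X - C (u j))
  have hq : ∀ b, (q b).natDegree < N := by
    intro b
    have hN : 0 < N := Fin.pos b
    simp only [q, natDegree_finsetProd_X_sub_C_eq_card, Finset.card_univ, Fintype.card_fin,
      Finset.card_erase_of_mem (Finset.mem_univ b)]
    omega
  have hqe : ∀ b x, (q b).eval x = ∏ j ∈ Finset.univ.erase b, (x - u j) := by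
    intro b x
    simp [q, eval_prod]
  let K : Matrix (Fin N) (Fin N) ℂ := Matrix.of fun k b => (q b).coeff k
  have hK : ∀ w : Fin N → ℂ,
      (Matrix.of fun a b => ∏ j ∈ Finset.univ.erase b, (w a - u j)) = vandermonde w * K := by
    intro w
    ext a b
    rw [Matrix.of_apply, ← hqe, eval_eq_sum_range' (hq b), Matrix.mul_apply,
      Finset.sum_range]
    simp [K, vandermonde_apply, mul_comm]
  have hdiag : (Matrix.of fun a b => ∏ j ∈ Finset.univ.erase b, (u a - u j)) =
      Matrix.diagonal fun b => ∏ j ∈ Finset.univ.erase b, (u b - u j) := by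
    ext a b
    rw [Matrix.of_apply, Matrix.diagonal_apply]
    split_ifs with h
    · rw [h]
    · exact Finset.prod_eq_zero (Finset.mem_erase.2 ⟨h, Finset.mem_univ a⟩) (sub_self _)
  have hV : (vandermonde u).det ≠ 0 := det_vandermonde_ne_zero_iff.2 hu
  have hprod : ∏ b, ∏ j ∈ Finset.univ.erase b, (u b - u j) =
      (vandermonde u).det * (vandermonde fun b => -u b).det := by
    have h : ∀ b : Fin N, (Finset.univ.erase b) = Finset.disjUnion (Finset.Iio b) (Finset.Ioi b)
        (Finset.disjoint_left.2 fun c h1 h2 => by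
          rw [Finset.mem_Iio] at h1; rw [Finset.mem_Ioi] at h2; exact lt_asymm h1 h2) := by
      intro b
      ext c
      simp only [Finset.mem_erase, Finset.mem_univ, and_true, Finset.mem_disjUnion,
        Finset.mem_Iio, Finset.mem_Ioi]
      exact lt_or_lt_iff_ne.symm
    simp only [h, Finset.prod_disjUnion, Finset.prod_mul_distrib, det_vandermonde]
    congr 1
    · exact Finset.prod_comm' (by simp)
    · refine Finset.prod_congr rfl fun b _ => Finset.prod_congr rfl fun c _ => by ring
  have hdetK : K.det = (vandermonde fun b => -u b).det := by
    have h := congrArg Matrix.det ((hK u).symm.trans hdiag)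
    rw [det_mul, det_diagonal, hprod] at h
    exact mul_left_cancel₀ hV h
  have hsplit : (Matrix.of fun a b => ∏ j ∈ Finset.univ.erase b, (y a - u j)) =
      Matrix.of fun a b => (∏ j, (y a - u j)) * (Matrix.of fun a b => (y a - u b)⁻¹) a b := by
    ext a b
    rw [Matrix.of_apply, Matrix.of_apply, Matrix.of_apply,
      ← Finset.mul_prod_erase _ _ (Finset.mem_univ b)]
    field_simp [hyu a b]
  have h := congrArg Matrix.det ((hK y).symm.trans hsplit)
  rw [det_mul, hdetK, det_mul_column] at h
  rw [h, mul_div_cancel_left₀]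
  exact Finset.prod_ne_zero_iff.2 fun a _ => Finset.prod_ne_zero_iff.2 fun b _ => hyu a b

/-- Partial fractions: `1 / (y_a - v)` in terms of the `1 / (y_a - u_j)`. -/
theorem inv_sub_eq_sum {N : ℕ} (y u : Fin N → ℂ) (v : ℂ) (hu : Function.Injective u)
    (hyu : ∀ a b, y a - u b ≠ 0) (hyv : ∀ a, v - y a ≠ 0) (huv : ∀ b, v - u b ≠ 0) (a : Fin N) :
    (y a - v)⁻¹ = (∏ j, (v - u j)) / (∏ c, (v - y c)) *
      ∑ j, (∏ c, (u j - y c)) / (∏ i ∈ Finset.univ.erase j, (u j - u i)) *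
        ((v - u j)⁻¹ * (y a - u j)⁻¹) := by
  let P : ℂ[X] := ∏ c, (X - C (y c)) - ∏ j, (X - C (u j))
  let d : Fin N → ℂ := fun j =>
    (∏ c, (u j - y c)) / (∏ i ∈ Finset.univ.erase j, (u j - u i))
  have hm : ∀ w : Fin N → ℂ, (∏ c, (X - C (w c))).Monic :=
    fun w => monic_prod_of_monic _ _ fun c _ => monic_X_sub_C _
  have hdeg : ∀ w : Fin N → ℂ, (∏ c, (X - C (w c))).degree = (N : WithBot ℕ) := by
    intro w
    rw [degree_eq_natDegree (hm w).ne_zero, natDegree_finsetProd_X_sub_C_eq_card,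
      Finset.card_univ, Fintype.card_fin]
  have hP : P.degree < N := by
    have h := degree_sub_lt_left ((hdeg y).trans (hdeg u).symm) (hm y).ne_zero
      ((hm y).leadingCoeff.trans (hm u).leadingCoeff.symm)
    rwa [hdeg] at h
  have hPe : ∀ x, P.eval x = (∏ c, (x - y c)) - ∏ j, (x - u j) := by
    intro x
    simp [P, eval_prod]
  have hnode : ∀ j, P.eval (u j) = ∏ c, (u j - y c) := by
    intro j
    rw [hPe, Finset.prod_eq_zero (f := fun i => u j - u i) (Finset.mem_univ j) (sub_self _),
      sub_zero]
  -- Lagrange interpolation of `∏ (X - y_c) - ∏ (X - u_j)` at the nodes `u_j`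
  have key : ∀ x, (∀ j, x - u j ≠ 0) →
      (∏ c, (x - y c)) - ∏ j, (x - u j) = (∏ j, (x - u j)) * ∑ j, d j * (x - u j)⁻¹ := by
    intro x hx
    have h := Lagrange.eq_interpolate (s := Finset.univ) (v := u) hu.injOn (f := P)
      (by simpa using hP)
    rw [← hPe, h, Lagrange.eval_interpolate_not_at_node _ fun j _ => sub_ne_zero.1 (hx j),
      Lagrange.eval_nodal]
    congr 1
    refine Finset.sum_congr rfl fun j _ => ?_
    simp only [hnode, Lagrange.nodalWeight, Finset.prod_inv_distrib, d]
    ring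
  have hU : ∀ x, (∀ j, x - u j ≠ 0) → ∏ j, (x - u j) ≠ 0 :=
    fun x hx => Finset.prod_ne_zero_iff.2 fun j _ => hx j
  have hQ : ∏ c, (v - y c) ≠ 0 := Finset.prod_ne_zero_iff.2 fun c _ => hyv c
  have ha : ∑ j, d j * (y a - u j)⁻¹ = -1 := by
    have h := key (y a) (hyu a)
    rw [Finset.prod_eq_zero (f := fun c => y a - y c) (Finset.mem_univ a) (sub_self _)] at h
    refine mul_left_cancel₀ (hU _ (hyu a)) ?_
    rw [← h]
    ring
  have hv := key v huv
  have hya : y a - v ≠ 0 := by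
    rw [← neg_sub, neg_ne_zero]; exact hyv a
  have hsum : ∑ j, d j * ((v - u j)⁻¹ * (y a - u j)⁻¹) =
      (∑ j, d j * (v - u j)⁻¹ + 1) * (y a - v)⁻¹ := by
    rw [← sub_neg_eq_add, ← ha, ← Finset.sum_sub_distrib, Finset.sum_mul]
    refine Finset.sum_congr rfl fun j _ => ?_
    have h1 := hyu a j
    have h2 := huv j
    field_simp
    ring
  change (y a - v)⁻¹ = (∏ j, (v - u j)) / (∏ c, (v - y c)) *
    ∑ j, d j * ((v - u j)⁻¹ * (y a - u j)⁻¹)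
  rw [hsum]
  have h3 : (∏ j, (v - u j)) * (∑ j, d j * (v - u j)⁻¹ + 1) = ∏ c, (v - y c) := by
    linear_combination -hv
  rw [← mul_assoc, div_mul_eq_mul_div, h3, div_self hQ, one_mul]

/-- A difference of two Cauchy matrices with common row variables. -/
theorem det_cauchy_sub_cauchy {N : ℕ} (y u v : Fin N → ℂ) (hu : Function.Injective u)
    (hyu : ∀ a b, y a - u b ≠ 0) (hyv : ∀ a b, v b - y a ≠ 0) (huv : ∀ a b, u a - v b ≠ 0) :
    (Matrix.of fun a b => (y a - u b)⁻¹ - (y a - v b)⁻¹).det =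
      (Matrix.of fun a b => (y a - u b)⁻¹).det *
        (1 + Matrix.of fun j k => (u j - v k)⁻¹ * ((∏ i, (v k - u i)) / (∏ c, (v k - y c)) *
          ((∏ c, (u k - y c)) / ∏ i ∈ Finset.univ.erase k, (u k - u i)))).det := by
  let g : Fin N → ℂ := fun k => (∏ i, (v k - u i)) / (∏ c, (v k - y c))
  let d : Fin N → ℂ := fun k => (∏ c, (u k - y c)) / ∏ i ∈ Finset.univ.erase k, (u k - u i)
  let M : Matrix (Fin N) (Fin N) ℂ := Matrix.of fun j k => (u j - v k)⁻¹ * g k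
  have huv' : ∀ a b, v b - u a ≠ 0 := fun a b => by
    rw [← neg_sub, neg_ne_zero]; exact huv a b
  have h1 : (Matrix.of fun a b => (y a - u b)⁻¹ - (y a - v b)⁻¹) =
      (Matrix.of fun a b => (y a - u b)⁻¹) * (1 + Matrix.diagonal d * M) := by
    ext a b
    rw [mul_add, mul_one, Matrix.add_apply, Matrix.mul_apply, Matrix.of_apply, Matrix.of_apply,
      inv_sub_eq_sum y u (v b) hu hyu (fun a => hyv a b) (fun a => huv' a b) a, sub_eq_add_neg,
      Finset.mul_sum, ← Finset.sum_neg_distrib]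
    congr 1
    refine Finset.sum_congr rfl fun j _ => ?_
    simp only [M, Matrix.diagonal_mul, Matrix.of_apply, d, g]
    rw [← neg_sub (u j) (v b), inv_neg]
    ring
  have h2 : (Matrix.of fun j k => (u j - v k)⁻¹ * (g k * d k)) = M * Matrix.diagonal d := by
    ext j k
    simp [M, mul_assoc]
  rw [h1, det_mul, det_one_add_mul_comm, ← h2]

end

/-! ### The inhomogeneous partition function -/

theorem rowVar_sub_rowVar_neg (η x l : ℂ) :
    rowVar η x - rowVar (-η) l = Complex.sinh (x + l) * Complex.sinh (x - l + η) := by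
  have h1 : 2 * x + η = (x + l) + (x - l + η) := by ring
  have h2 : 2 * l + -η = (x + l) - (x - l + η) := by ring
  rw [rowVar, rowVar, h1, h2, Complex.cosh_add (x + l), Complex.cosh_sub (x + l)]
  ring

/-- The closed form of the partition function with arbitrary horizontal parameters. -/
noncomputable def inhomogeneousForm {N : ℕ} (η : ℂ) (xi lam : Fin N → ℂ) (ξm : ℂ) : ℂ :=
  (∏ a, (Complex.sinh (2 * xi a) * Complex.sinh (lam a + ξm)) / Complex.sinh (2 * lam a)) *
    (∏ a, ∏ b ∈ Finset.Ioi a,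
      Complex.sinh (lam a + lam b + η) / Complex.sinh (lam a + lam b)) *
    (∏ a, ∏ b, Complex.sinh (xi a + lam b) * Complex.sinh (xi a - lam b + η)) *
    (1 + matUtilde η xi lam).det

/-- The matrix `Ũ` is a Cauchy matrix multiplied by a diagonal one. -/
theorem matUtilde_eq {N : ℕ} (η : ℂ) (xi lam : Fin N → ℂ)
    (hsumη : ∀ a b : Fin N, Complex.sinh (lam a + lam b + η) ≠ 0) :
    matUtilde η xi lam = Matrix.of fun j k =>
      (rowVar η (lam j) - rowVar (-η) (lam k))⁻¹ *
        ((∏ i, (rowVar (-η) (lam k) - rowVar η (lam i))) /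
          (∏ c, (rowVar (-η) (lam k) - rowVar η (xi c))) *
        ((∏ c, (rowVar η (lam k) - rowVar η (xi c))) /
          ∏ i ∈ Finset.univ.erase k, (rowVar η (lam k) - rowVar η (lam i)))) := by
  ext j k
  have e1 : ∏ i, (rowVar (-η) (lam k) - rowVar η (lam i)) =
      (∏ a, Complex.sinh (lam k - lam a - η)) * ∏ a, Complex.sinh (lam a + lam k) := by
    rw [← Finset.prod_mul_distrib]
    refine Finset.prod_congr rfl fun i _ => ?_
    rw [← neg_sub, rowVar_sub_rowVar_neg, show lam k - lam i - η = -(lam i - lam k + η) by ring,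
      Complex.sinh_neg]
    ring
  have e2 : (∏ c, (rowVar η (lam k) - rowVar η (xi c))) /
      (∏ c, (rowVar (-η) (lam k) - rowVar η (xi c))) =
      ∏ a, (Complex.sinh (xi a - lam k) * Complex.sinh (xi a + lam k + η)) /
        (Complex.sinh (xi a + lam k) * Complex.sinh (xi a - lam k + η)) := by
    rw [← Finset.prod_div_distrib]
    refine Finset.prod_congr rfl fun c _ => ?_
    rw [← neg_sub, ← neg_sub (rowVar η (xi c)), neg_div_neg_eq, rowVar_sub_rowVar_neg, rowVar_sub,
      mul_comm (Complex.sinh (xi c - lam k))]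
  have e3 : ∏ i ∈ Finset.univ.erase k, (rowVar η (lam k) - rowVar η (lam i)) =
      (∏ a, Complex.sinh (lam a + lam k + η)) / Complex.sinh (2 * lam k + η) *
        ∏ a ∈ Finset.univ.erase k, Complex.sinh (lam k - lam a) := by
    have h := hsumη k k
    rw [← Finset.mul_prod_erase Finset.univ _ (Finset.mem_univ k), two_mul,
      mul_div_cancel_left₀ _ h, ← Finset.prod_mul_distrib]
    refine Finset.prod_congr rfl fun i _ => ?_
    rw [rowVar_sub, add_comm (lam k) (lam i)]
  rw [matUtilde, Matrix.of_apply, Matrix.of_apply, e1, e3, ← e2, rowVar_sub_rowVar_neg,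
    Finset.prod_div_distrib, add_comm (lam k) (lam j)]
  simp only [div_eq_mul_inv, mul_inv, inv_inv]
  ring

/-- For generic `ξ_a` one can divide by the Vandermonde determinants in the determinant formula. -/
theorem partitionZ_eq_inhomogeneousForm {N : ℕ} (η : ℂ) (xi lam : Fin N → ℂ) (ξm : ℂ)
    (hη : Complex.sinh η ≠ 0)
    (hdiff : ∀ a b : Fin N, a ≠ b → Complex.sinh (lam a - lam b) ≠ 0)
    (hsum : ∀ a b : Fin N, Complex.sinh (lam a + lam b) ≠ 0)
    (hsumη : ∀ a b : Fin N, Complex.sinh (lam a + lam b + η) ≠ 0)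
    (hdiffη : ∀ a b : Fin N, Complex.sinh (lam a - lam b + η) ≠ 0)
    (xdiff : ∀ a b : Fin N, a ≠ b → Complex.sinh (xi a - xi b) ≠ 0)
    (xdiffη : ∀ a b : Fin N, a ≠ b → Complex.sinh (xi a - xi b + η) ≠ 0)
    (xsum : ∀ a b : Fin N, Complex.sinh (xi a + xi b) ≠ 0)
    (xsumη : ∀ a b : Fin N, a ≠ b → Complex.sinh (xi a + xi b + η) ≠ 0)
    (hxsum : ∀ a b : Fin N, Complex.sinh (xi a + lam b) ≠ 0)
    (hxdiff : ∀ a b : Fin N, Complex.sinh (xi a - lam b) ≠ 0)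
    (hxsumη : ∀ a b : Fin N, Complex.sinh (xi a + lam b + η) ≠ 0)
    (hxdiffη : ∀ a b : Fin N, Complex.sinh (xi a - lam b + η) ≠ 0) :
    partitionZ η xi lam ξm = inhomogeneousForm η xi lam ξm := by
  have hT : DetFormula η ξm xi lam := by
    refine detFormula η ξm xi lam xdiffη ?_ ?_
    · rintro (a | a) (b | b)
      · exact xsum a b
      · exact hxsum a b
      · simpa [add_comm] using hxsum b a
      · exact hsum a b
    · rintro (a | a) (b | b) hab
      · exact xdiff a b fun h => hab (congrArg _ h)
      · exact hxdiff a b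
      · simp only [Sum.elim_inr, Sum.elim_inl]
        rw [← neg_sub, Complex.sinh_neg, neg_ne_zero]
        exact hxdiff b a
      · exact hdiff a b fun h => hab (congrArg _ h)
  have hyu : ∀ a b, (rowVar η ∘ xi) a - (rowVar η ∘ lam) b ≠ 0 := fun a b => by
    rw [Function.comp_apply, Function.comp_apply, rowVar_sub]
    exact mul_ne_zero (hxsumη a b) (hxdiff a b)
  have hyv : ∀ a b, (rowVar (-η) ∘ lam) b - (rowVar η ∘ xi) a ≠ 0 := fun a b => by
    rw [← neg_sub, neg_ne_zero, Function.comp_apply, Function.comp_apply, rowVar_sub_rowVar_neg]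
    exact mul_ne_zero (hxsum a b) (hxdiffη a b)
  have huv : ∀ a b, (rowVar η ∘ lam) a - (rowVar (-η) ∘ lam) b ≠ 0 := fun a b => by
    rw [Function.comp_apply, Function.comp_apply, rowVar_sub_rowVar_neg]
    exact mul_ne_zero (hsum a b) (hdiffη a b)
  have hu : Function.Injective (rowVar η ∘ lam) := by
    intro a b hab
    by_contra hne
    have h := rowVar_sub η (lam a) (lam b)
    simp only [Function.comp_apply] at hab
    rw [hab, sub_self] at h
    exact mul_ne_zero (hsumη a b) (hdiff a b hne) h.symm
  have hVy : (vandermonde (rowVar η ∘ xi)).det ≠ 0 := by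
    refine det_vandermonde_ne_zero_iff.2 fun a b hab => ?_
    by_contra hne
    have h := rowVar_sub η (xi a) (xi b)
    simp only [Function.comp_apply] at hab
    rw [hab, sub_self] at h
    exact mul_ne_zero (xsumη a b hne) (xdiff a b hne) h.symm
  have hVx : (vandermonde (colVar ∘ lam)).det ≠ 0 := by
    refine det_vandermonde_ne_zero_iff.2 fun a b hab => ?_
    by_contra hne
    have h := colVar_sub (lam a) (lam b)
    simp only [Function.comp_apply] at hab
    rw [hab, sub_self] at h
    exact mul_ne_zero (hsum b a) (hdiff b a (Ne.symm hne)) h.symm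
  have huv_self : ∀ b, rowVar η (lam b) - rowVar (-η) (lam b) =
      Complex.sinh (2 * lam b) * Complex.sinh η := fun b => by
    rw [rowVar_sub_rowVar_neg, ← two_mul, sub_self, zero_add]
  have h2l : ∀ b, Complex.sinh (2 * lam b) ≠ 0 := fun b => by
    rw [two_mul]; exact hsum b b
  have hcw : ∀ a b, crossWeight η (xi a) (lam b) =
      (rowVar η (xi a) - rowVar η (lam b)) * (rowVar η (xi a) - rowVar (-η) (lam b)) := by
    intro a b
    rw [rowVar_sub, rowVar_sub_rowVar_neg, crossWeight]
  -- each column of the weight matrix is a multiple of a difference of Cauchy columns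
  have hW : weightMatrix η xi lam = Matrix.of fun a b =>
      ((∏ c, crossWeight η (xi c) (lam b)) / (Complex.sinh (2 * lam b) * Complex.sinh η)) *
      (Matrix.of fun a b => ((rowVar η ∘ xi) a - (rowVar η ∘ lam) b)⁻¹ -
        ((rowVar η ∘ xi) a - (rowVar (-η) ∘ lam) b)⁻¹) a b := by
    ext a b
    have n1 := hyu a b
    have n2 : (rowVar η ∘ xi) a - (rowVar (-η) ∘ lam) b ≠ 0 := by
      rw [← neg_sub, neg_ne_zero]; exact hyv a b
    have n3 := h2l b
    simp only [Function.comp_apply] at n1 n2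
    simp only [weightMatrix, Matrix.of_apply, Function.comp_apply]
    rw [← Finset.mul_prod_erase _ _ (Finset.mem_univ a), inv_sub_inv n1 n2,
      sub_sub_sub_cancel_left, ← huv_self, hcw]
    have n4 : rowVar η (lam b) - rowVar (-η) (lam b) ≠ 0 := huv b b
    field_simp
  have hdetW : (weightMatrix η xi lam).det =
      (∏ b, ((∏ c, crossWeight η (xi c) (lam b)) /
        (Complex.sinh (2 * lam b) * Complex.sinh η))) *
      ((vandermonde (rowVar η ∘ xi)).det * (vandermonde fun b => -(rowVar η ∘ lam) b).det /
        (∏ a, ∏ b, ((rowVar η ∘ xi) a - (rowVar η ∘ lam) b)) *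
      (1 + matUtilde η xi lam).det) := by
    rw [hW, det_mul_row, det_cauchy_sub_cauchy _ _ _ hu hyu hyv huv, det_cauchy _ _ hu hyu,
      matUtilde_eq η xi lam hsumη]
    rfl
  have hratio : (vandermonde fun b => -(rowVar η ∘ lam) b).det =
      (∏ a, ∏ b ∈ Finset.Ioi a,
        Complex.sinh (lam a + lam b + η) / Complex.sinh (lam a + lam b)) *
      (vandermonde (colVar ∘ lam)).det := by
    rw [det_vandermonde, det_vandermonde, ← Finset.prod_mul_distrib]
    refine Finset.prod_congr rfl fun a _ => ?_
    rw [← Finset.prod_mul_distrib]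
    refine Finset.prod_congr rfl fun b _ => ?_
    have n := hsum a b
    simp only [Function.comp_apply]
    rw [neg_sub_neg, rowVar_sub, colVar_sub]
    field_simp
  have hcross : ∏ b, ∏ c, crossWeight η (xi c) (lam b) =
      (∏ a, ∏ b, ((rowVar η ∘ xi) a - (rowVar η ∘ lam) b)) *
      ∏ a, ∏ b, Complex.sinh (xi a + lam b) * Complex.sinh (xi a - lam b + η) := by
    rw [Finset.prod_comm]
    simp only [← Finset.prod_mul_distrib]
    refine Finset.prod_congr rfl fun a _ => Finset.prod_congr rfl fun b _ => ?_
    rw [hcw, ← rowVar_sub_rowVar_neg]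
    rfl
  have hyuP : ∏ a, ∏ b, ((rowVar η ∘ xi) a - (rowVar η ∘ lam) b) ≠ 0 :=
    Finset.prod_ne_zero_iff.2 fun a _ => Finset.prod_ne_zero_iff.2 fun b _ => hyu a b
  have h2lP : ∏ b, Complex.sinh (2 * lam b) ≠ 0 := Finset.prod_ne_zero_iff.2 fun b _ => h2l b
  have hηP : ∏ _b : Fin N, Complex.sinh η ≠ 0 := Finset.prod_ne_zero_iff.2 fun b _ => hη
  rw [DetFormula, hdetW, hratio, Finset.prod_div_distrib, hcross] at hT
  refine mul_right_cancel₀ (mul_ne_zero hVy hVx) ?_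
  rw [← mul_assoc, hT, inhomogeneousForm]
  simp only [Finset.prod_div_distrib, Finset.prod_mul_distrib]
  field_simp

/-! ### The homogeneous limit -/

open Filter Topology

theorem continuous_Rmat_apply (η : ℂ) (p q : Fin 2 × Fin 2) : Continuous fun u => Rmat η u p q := by
  obtain ⟨s, i⟩ := p
  obtain ⟨t, j⟩ := q
  simp only [Rmat_apply]
  split_ifs <;> fun_prop

theorem continuous_Rak {N : ℕ} (η : ℂ) (k : Fin N) : Continuous fun u => Rak η k u := by
  refine continuous_matrix fun s t => continuous_matrix fun σ τ => ?_
  simp only [Rak, siteOp, Matrix.of_apply]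
  split_ifs
  · exact continuous_Rmat_apply _ _ _
  · exact continuous_const

theorem continuous_Cminus {N : ℕ} (η : ℂ) (lam : Fin N → ℂ) (ξm : ℂ) :
    Continuous (Cminus η lam ξm) := by
  have h : Cminus η lam ξm = fun u => listMonodromy η lam ξm u (List.finRange N) 1 0 :=
    funext fun u => by rw [Cminus, boundaryMonodromy_eq_listMonodromy]
  suffices hc : Continuous fun u => listMonodromy η lam ξm u (List.finRange N) from
    h ▸ hc.matrix_elem 1 0
  simp only [listMonodromy, ← List.map_reverse, Rka_eq_Rak]
  refine Continuous.mul (Continuous.mul ?_ ?_) ?_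
  · exact continuous_list_prod (f := fun k u => Rak η k (u - lam k)) _ fun k _ =>
      (continuous_Rak η k).comp (continuous_id.sub continuous_const)
  · refine continuous_matrix fun s t => ?_
    simp only [Kminus, Matrix.of_apply]
    have hk : Continuous fun u => Kmat ξm u s t := by
      fin_cases s <;> fin_cases t <;> simp [Kmat] <;> fun_prop
    exact hk.smul continuous_const
  · exact continuous_list_prod (f := fun k u => Rak η k (u + lam k)) _ fun k _ =>
      (continuous_Rak η k).comp (continuous_id.add continuous_const)

theorem continuous_partitionZ {N : ℕ} (η : ℂ) (lam : Fin N → ℂ) (ξm : ℂ) :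
    Continuous fun xi : Fin N → ℂ => partitionZ η xi lam ξm := by
  simp only [partitionZ, List.ofFn_eq_map]
  exact (continuous_list_prod _ fun a _ =>
    (continuous_Cminus η lam ξm).comp (continuous_apply a)).matrix_elem _ _

theorem continuousAt_inhomogeneousForm {N : ℕ} (η : ℂ) (xi lam : Fin N → ℂ) (ξm : ℂ)
    (h1 : ∀ a b, Complex.sinh (xi a + lam b) ≠ 0)
    (h2 : ∀ a b, Complex.sinh (xi a - lam b + η) ≠ 0) :
    ContinuousAt (fun xi : Fin N → ℂ => inhomogeneousForm η xi lam ξm) xi := by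
  have hU : ContinuousAt (fun xi : Fin N → ℂ => matUtilde η xi lam) xi := by
    refine continuousAt_pi.2 fun j => continuousAt_pi.2 fun k => ?_
    simp only [matUtilde, Matrix.of_apply]
    refine continuousAt_const.mul (tendsto_finsetProd _ fun a _ => ?_)
    refine ContinuousAt.div ?_ ?_ (mul_ne_zero (h1 a k) (h2 a k)) <;> fun_prop
  have hdet : ContinuousAt (fun xi : Fin N → ℂ => (1 + matUtilde η xi lam).det) xi :=
    ((continuous_id.matrix_det).continuousAt).comp (f := fun xi => 1 + matUtilde η xi lam)
      (continuousAt_const.add hU)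
  refine ContinuousAt.mul (Continuous.continuousAt ?_) hdet
  fun_prop

/-- For `q ≠ 0` the zero set of `t ↦ sinh (p + t q)` is discrete. -/
theorem eventually_sinh_ne_zero (p : ℂ) {q : ℂ} (hq : q ≠ 0) :
    ∀ᶠ t in 𝓝[≠] (0 : ℂ), Complex.sinh (p + t * q) ≠ 0 := by
  have hd : HasDerivAt (fun t : ℂ => Complex.sinh (p + t * q))
      (Complex.cosh (p + 0 * q) * q) 0 := by
    have h := ((hasDerivAt_id (0 : ℂ)).mul_const q).const_add p
    simpa using h.csinh
  by_cases h : Complex.sinh p = 0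
  · refine hd.eventually_ne (mul_ne_zero ?_ hq)
    intro hc
    rw [zero_mul, add_zero] at hc
    have := Complex.cosh_sq p
    rw [hc, h] at this
    norm_num at this
  · have hc := hd.continuousAt.eventually_ne (y := 0) (by simpa using h)
    exact hc.filter_mono nhdsWithin_le_nhds

/-- The points `ξ_a = x + (a + 1) t` with small `t ≠ 0` are generic, so that the closed form extends
to `ξ_a = x` by continuity, although the determinant formula degenerates there. -/
theorem partitionZ_eq_inhomogeneousForm_const {N : ℕ} (η x : ℂ) (lam : Fin N → ℂ) (ξm : ℂ)
    (hη : Complex.sinh η ≠ 0)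
    (hdiff : ∀ a b : Fin N, a ≠ b → Complex.sinh (lam a - lam b) ≠ 0)
    (hsum : ∀ a b : Fin N, Complex.sinh (lam a + lam b) ≠ 0)
    (hsumη : ∀ a b : Fin N, Complex.sinh (lam a + lam b + η) ≠ 0)
    (hdiffη : ∀ a b : Fin N, Complex.sinh (lam a - lam b + η) ≠ 0)
    (hx : ∀ b, Complex.sinh (x + lam b) ≠ 0) (hxη : ∀ b, Complex.sinh (x - lam b + η) ≠ 0) :
    partitionZ η (fun _ => x) lam ξm = inhomogeneousForm η (fun _ => x) lam ξm := by
  let xi : ℂ → Fin N → ℂ := fun t a => x + t * ((a : ℕ) + 1 : ℕ)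
  have hxi0 : xi 0 = fun _ => x := by
    funext a; simp [xi]
  have hxic : Continuous xi := continuous_pi fun a => by fun_prop
  have hxit : Tendsto xi (𝓝[≠] 0) (𝓝 fun _ => x) := by
    rw [← hxi0]
    exact hxic.continuousAt.tendsto.mono_left nhdsWithin_le_nhds
  have hpos : ∀ a : Fin N, (((a : ℕ) + 1 : ℕ) : ℂ) ≠ 0 := fun a => Nat.cast_ne_zero.2 (by omega)
  have hpos2 : ∀ a b : Fin N, (((a : ℕ) + 1 : ℕ) + ((b : ℕ) + 1 : ℕ) : ℂ) ≠ 0 := fun a b => by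
    rw [← Nat.cast_add]; exact Nat.cast_ne_zero.2 (by omega)
  have hneg : ∀ a b : Fin N, a ≠ b → (((a : ℕ) + 1 : ℕ) - ((b : ℕ) + 1 : ℕ) : ℂ) ≠ 0 :=
    fun a b hab h => by
      rw [sub_eq_zero, Nat.cast_inj] at h
      exact hab (Fin.ext (by omega))
  have hev : ∀ᶠ t in 𝓝[≠] (0 : ℂ), partitionZ η (xi t) lam ξm =
      inhomogeneousForm η (xi t) lam ξm := by
    -- a condition affine in `t` holds for small `t ≠ 0`
    have gen : ∀ (f : ℂ → ℂ) (p q : ℂ), q ≠ 0 → (∀ t, f t = p + t * q) →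
        ∀ᶠ t in 𝓝[≠] (0 : ℂ), Complex.sinh (f t) ≠ 0 := by
      intro f p q hq hf
      simpa only [hf] using eventually_sinh_ne_zero p hq
    have e1 : ∀ᶠ t in 𝓝[≠] (0 : ℂ), ∀ a b, a ≠ b → Complex.sinh (xi t a - xi t b) ≠ 0 := by
      simp only [eventually_all]
      exact fun a b hab => gen _ 0 _ (hneg a b hab) fun t => by simp only [xi]; ring
    have e2 : ∀ᶠ t in 𝓝[≠] (0 : ℂ), ∀ a b, a ≠ b → Complex.sinh (xi t a - xi t b + η) ≠ 0 := by
      simp only [eventually_all]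
      exact fun a b hab => gen _ η _ (hneg a b hab) fun t => by simp only [xi]; ring
    have e3 : ∀ᶠ t in 𝓝[≠] (0 : ℂ), ∀ a b, Complex.sinh (xi t a + xi t b) ≠ 0 := by
      simp only [eventually_all]
      exact fun a b => gen _ (2 * x) _ (hpos2 a b) fun t => by simp only [xi]; ring
    have e4 : ∀ᶠ t in 𝓝[≠] (0 : ℂ), ∀ a b, a ≠ b → Complex.sinh (xi t a + xi t b + η) ≠ 0 := by
      simp only [eventually_all]
      exact fun a b _ => gen _ (2 * x + η) _ (hpos2 a b) fun t => by simp only [xi]; ring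
    have e5 : ∀ᶠ t in 𝓝[≠] (0 : ℂ), ∀ a b, Complex.sinh (xi t a + lam b) ≠ 0 := by
      simp only [eventually_all]
      exact fun a b => gen _ (x + lam b) _ (hpos a) fun t => by simp only [xi]; ring
    have e6 : ∀ᶠ t in 𝓝[≠] (0 : ℂ), ∀ a b, Complex.sinh (xi t a - lam b) ≠ 0 := by
      simp only [eventually_all]
      exact fun a b => gen _ (x - lam b) _ (hpos a) fun t => by simp only [xi]; ring
    have e7 : ∀ᶠ t in 𝓝[≠] (0 : ℂ), ∀ a b, Complex.sinh (xi t a + lam b + η) ≠ 0 := by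
      simp only [eventually_all]
      exact fun a b => gen _ (x + lam b + η) _ (hpos a) fun t => by simp only [xi]; ring
    have e8 : ∀ᶠ t in 𝓝[≠] (0 : ℂ), ∀ a b, Complex.sinh (xi t a - lam b + η) ≠ 0 := by
      simp only [eventually_all]
      exact fun a b => gen _ (x - lam b + η) _ (hpos a) fun t => by simp only [xi]; ring
    filter_upwards [e1, e2, e3, e4, e5, e6, e7, e8] with t t1 t2 t3 t4 t5 t6 t7 t8
    exact partitionZ_eq_inhomogeneousForm η (xi t) lam ξm hη hdiff hsum hsumη hdiffη
      t1 t2 t3 t4 t5 t6 t7 t8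
  have hL := ((continuous_partitionZ η lam ξm).tendsto fun _ => x).comp hxit
  have hR := (continuousAt_inhomogeneousForm η (fun _ => x) lam ξm (fun _ => hx)
    fun _ => hxη).tendsto.comp hxit
  exact tendsto_nhds_unique (hL.congr' hev) hR

/-! ### The Bethe equations -/

theorem SolvesBethe.sinh_sub_ne_zero {N : ℕ} {η β h T : ℂ} {lam : Fin N → ℂ}
    (hB : SolvesBethe η β h T lam) (p k : Fin N) : Complex.sinh (lam p - lam k - η) ≠ 0 := by
  intro h0
  have h := hB p
  rw [Finset.prod_eq_zero (Finset.mem_univ k) (by rw [h0, div_zero])] at h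
  simp at h

theorem SolvesBethe.ratio_ne_zero {N : ℕ} {η β h T : ℂ} {lam : Fin N → ℂ}
    (hB : SolvesBethe η β h T lam) (p : Fin N) :
    (Complex.sinh (lam p + β / N - η) * Complex.sinh (lam p - β / N)) /
      (Complex.sinh (lam p - β / N + η) * Complex.sinh (lam p + β / N)) ≠ 0 := by
  intro h0
  have h := hB p
  rw [h0, zero_pow (Fin.pos p).ne'] at h
  simp at h

/-- The Bethe equations remove the horizontal parameters from `Ũ`. -/
theorem SolvesBethe.matUtilde_eq_matU {N : ℕ} {η β h T : ℂ} {lam : Fin N → ℂ}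
    (hB : SolvesBethe η β h T lam) :
    matUtilde η (fun _ => -(β / N)) lam = matU η (h / T) lam := by
  ext j k
  have hr := hB.ratio_ne_zero k
  have hk := hB k
  have hden : ∏ a, Complex.sinh (lam k - lam a - η) ≠ 0 :=
    Finset.prod_ne_zero_iff.2 fun a _ => hB.sinh_sub_ne_zero k a
  have e : (Complex.sinh (-(β / N) - lam k) * Complex.sinh (-(β / N) + lam k + η)) /
      (Complex.sinh (-(β / N) + lam k) * Complex.sinh (-(β / N) - lam k + η)) =
      ((Complex.sinh (lam k + β / N - η) * Complex.sinh (lam k - β / N)) /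
      (Complex.sinh (lam k - β / N + η) * Complex.sinh (lam k + β / N)))⁻¹ := by
    rw [inv_div, show -(β / N) - lam k = -(lam k + β / N) by ring,
      show -(β / N) + lam k + η = lam k - β / N + η by ring,
      show -(β / N) + lam k = lam k - β / N by ring,
      show -(lam k + β / N) + η = -(lam k + β / N - η) by ring, Complex.sinh_neg, Complex.sinh_neg,
      neg_mul, mul_neg, neg_div_neg_eq, mul_comm (Complex.sinh (lam k + β / N)),
      mul_comm (Complex.sinh (lam k - β / N))]
  have key : (∏ a, Complex.sinh (lam k - lam a - η)) *
      (((Complex.sinh (lam k + β / N - η) * Complex.sinh (lam k - β / N)) /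
      (Complex.sinh (lam k - β / N + η) * Complex.sinh (lam k + β / N)))⁻¹) ^ N =
      -(Complex.exp (-(h / T)) * ∏ a, Complex.sinh (lam k - lam a + η)) := by
    rw [Finset.prod_div_distrib] at hk
    set r := (Complex.sinh (lam k + β / N - η) * Complex.sinh (lam k - β / N)) /
      (Complex.sinh (lam k - β / N + η) * Complex.sinh (lam k + β / N))
    have hrN : r ^ N ≠ 0 := pow_ne_zero _ hr
    rw [inv_pow]
    field_simp at hk ⊢
    linear_combination -hk
  simp only [matUtilde, matU, Matrix.of_apply, Finset.prod_const, Finset.card_univ,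
    Fintype.card_fin, e]
  linear_combination (Complex.sinh (2 * lam k + η) /
      (Complex.sinh (lam k + lam j) * Complex.sinh (lam j - lam k + η))) /
    (∏ a ∈ Finset.univ.erase k, Complex.sinh (lam k - lam a)) *
    (∏ a, Complex.sinh (lam a + lam k) / Complex.sinh (lam a + lam k + η)) * key

end OpenXXZ

theorem mainTheorem3 (N : ℕ) (η β h T ξm : ℂ) (hT : T ≠ 0) (lam : Fin N → ℂ)
    (hBethe : OpenXXZ.SolvesBethe η β h T lam)
    (hdiff : ∀ a b : Fin N, a ≠ b → Complex.sinh (lam a - lam b) ≠ 0)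
    (hsum : ∀ a b : Fin N, Complex.sinh (lam a + lam b) ≠ 0)
    (hsumη : ∀ a b : Fin N, Complex.sinh (lam a + lam b + η) ≠ 0) :
    Filter.Tendsto (fun xi : Fin N → ℂ => OpenXXZ.partitionZ η xi lam ξm)
        (nhds (fun _ => -(β / N))) (nhds (OpenXXZ.homogeneousForm η β (h / T) ξm lam)) ∧
      OpenXXZ.partitionZ η (fun _ => -(β / N)) lam ξm =
        OpenXXZ.homogeneousForm η β (h / T) ξm lam ∧
      OpenXXZ.matUtilde η (fun _ => -(β / N)) lam = OpenXXZ.matU η (h / T) lam := by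
  have hU := hBethe.matUtilde_eq_matU
  have hZ : OpenXXZ.partitionZ η (fun _ => -(β / N)) lam ξm =
      OpenXXZ.homogeneousForm η β (h / T) ξm lam := by
    rcases Nat.eq_zero_or_pos N with rfl | hN
    · have h0 : (fun _ => 0 : OpenXXZ.Config 0) = fun _ => 1 := Subsingleton.elim _ _
      simp [OpenXXZ.partitionZ, OpenXXZ.homogeneousForm, h0]
    have hη : Complex.sinh η ≠ 0 := by
      have := hBethe.sinh_sub_ne_zero ⟨0, hN⟩ ⟨0, hN⟩
      simpa using this
    have hdiffη : ∀ a b : Fin N, Complex.sinh (lam a - lam b + η) ≠ 0 := fun a b => by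
      rw [show lam a - lam b + η = -(lam b - lam a - η) by ring, Complex.sinh_neg, neg_ne_zero]
      exact hBethe.sinh_sub_ne_zero b a
    have hx : ∀ b, Complex.sinh (-(β / N) + lam b) ≠ 0 := fun b => by
      rw [show -(β / N) + lam b = lam b - β / N by ring]
      exact fun h0 => hBethe.ratio_ne_zero b (by rw [h0, mul_zero, zero_div])
    have hxη : ∀ b, Complex.sinh (-(β / N) - lam b + η) ≠ 0 := fun b => by
      rw [show -(β / N) - lam b + η = -(lam b + β / N - η) by ring, Complex.sinh_neg, neg_ne_zero]
      exact fun h0 => hBethe.ratio_ne_zero b (by rw [h0, zero_mul, zero_div])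
    rw [OpenXXZ.partitionZ_eq_inhomogeneousForm_const η _ lam ξm hη hdiff hsum hsumη hdiffη hx hxη,
      OpenXXZ.inhomogeneousForm, OpenXXZ.homogeneousForm, hU, Finset.prod_comm (s := Finset.univ)
        (t := Finset.univ)]
    simp only [Finset.prod_const, Finset.card_univ, Fintype.card_fin]
    congr 3
    · refine Finset.prod_congr rfl fun a _ => ?_
      congr 3
      ring
    · funext a
      congr 3 <;> ring
  refine ⟨?_, hZ, hU⟩
  rw [← hZ]
  exact (OpenXXZ.continuous_partitionZ η lam ξm).tendsto _
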